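/- Let $(\epsilon_i)_{i\in\mathbb{Z}}$ be i.i.d. real random variables with $\mathbb{E}\epsilon_0=0$, $\mathbb{E}\epsilon_0^2=1$ and $\mathbb{E}|\epsilon_0|^3<\infty$, and let $(\alpha_j)_{j\ge 0}$ be real numbers with $\sum_{j\ge 0}|\alpha_j|<\infty$ and $\sum_{j\ge 0}\alpha_j\neq 0$. For $k\in\mathbb{Z}$ let $X_k=\sum_{j\ge 0}\alpha_j\epsilon_{k-j}$ (the series converges absolutely almost surely), and put $s=\bigl|\sum_{j\ge 0}\alpha_j\bigr|$. Let $\Phi$ be the distribution function of $N(0,1)$ and, for $n\ge 1$, $$\Delta_n=\sup_{x\in\mathbb{R}}\Bigl|\mathbb{P}\Bigl(\sum_{k=1}^n X_k\le x\sqrt{n s^2}\Bigr)-\Phi(x)\Bigr|,\qquad R_n=n^{-1}\sum_{j\ge 1}\min(j,n)\,|\alpha_j| .$$ Then there is a constant $C$, depending only on $\sum_{j\ge 0}|\alpha_j|$, $s$ and $\mathbb{E}|\epsilon_0|^3$, such that $$\Delta_n\le C\bigl(n^{-1/2}+R_n\bigr)\qquad\text{for all } n\ge 1 .$$ Moreover,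 this bound is sharp up to a multiplicative constant: there exist linear processes $(X_k)$ satisfying all the above assumptions, one with $\sqrt{n}\,R_n\to\infty$ and another one with $(\sqrt{n}\,R_n)_{n\ge1}$ bounded, for each of which there is a constant $c>0$ with $$\Delta_n\ge c\bigl(n^{-1/2}+R_n\bigr)\qquad\text{for all } n\ge 1 .$$ -/

import Mathlib

open MeasureTheory ProbabilityTheory Filter

noncomputable section

/-- `(ε i)`, `i ∈ ℤ`, is an i.i.d. sequence of real random variables under `P` with mean zero,
unit variance and finite third absolute moment. (Almost everywhere measurability of each `ε i` is
part of `IdentDistrib`.) -/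
structure IsInnovationSequence {Ω : Type*} [MeasurableSpace Ω] (P : Measure Ω)
    (ε : ℤ → Ω → ℝ) : Prop where
  indep : iIndepFun ε P
  identDistrib : ∀ i, IdentDistrib (ε i) (ε 0) P P
  mean_eq_zero : ∫ ω, ε 0 ω ∂P = 0
  second_moment : ∫ ω, (ε 0 ω) ^ 2 ∂P = 1
  third_moment : Integrable (fun ω => |ε 0 ω| ^ 3) P

/-- Absolutely summable coefficients with non-zero sum. -/
structure IsAdmissibleCoeff (α : ℕ → ℝ) : Prop where
  summable_abs : Summable fun j => |α j|
  tsum_ne_zero : ∑' j, α j ≠ 0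

/-- The linear process `X_k = ∑_{j ≥ 0} α_j ε_{k-j}`. -/
def linearProcess {Ω : Type*} (α : ℕ → ℝ) (ε : ℤ → Ω → ℝ) (k : ℤ) (ω : Ω) : ℝ :=
  ∑' j : ℕ, α j * ε (k - (j : ℤ)) ω

/-- The partial sum `S_n = X_1 + ⋯ + X_n` of the linear process. -/
def partialSum {Ω : Type*} (α : ℕ → ℝ) (ε : ℤ → Ω → ℝ) (n : ℕ) (ω : Ω) : ℝ :=
  ∑ k ∈ Finset.Icc 1 n, linearProcess α ε (k : ℤ) ω

/-- The normalisation `s = |∑_{j ≥ 0} α_j|`. -/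
def longRunStd (α : ℕ → ℝ) : ℝ := |∑' j, α j|

/-- `sup_x |P(S_n ≤ x √(n s²)) - Φ(x)|`, with `Φ` the standard normal distribution function. -/
def normalDistance {Ω : Type*} [MeasurableSpace Ω] (P : Measure Ω) (α : ℕ → ℝ)
    (ε : ℤ → Ω → ℝ) (n : ℕ) : ℝ :=
  ⨆ x : ℝ, |P.real {ω | partialSum α ε n ω ≤ x * √((n : ℝ) * longRunStd α ^ 2)}
    - cdf (gaussianReal 0 1) x|

/-- `n⁻¹ ∑_{j ≥ 1} (j ∧ n) |α_j|`; the summation variable below is `j - 1`. -/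
def biasTerm (α : ℕ → ℝ) (n : ℕ) : ℝ :=
  (n : ℝ)⁻¹ * ∑' j : ℕ, min ((j : ℝ) + 1) (n : ℝ) * |α (j + 1)|

/-- The rate `n^{-1/2} + n⁻¹ ∑_{j ≥ 1} (j ∧ n) |α_j|`. -/
def rate (α : ℕ → ℝ) (n : ℕ) : ℝ := (n : ℝ) ^ (-(1 / 2) : ℝ) + biasTerm α n

/-- The bound is attained, up to a multiplicative constant, by the linear process with
coefficients `α` and innovations `ε`. -/
def AttainsRate {Ω : Type*} [MeasurableSpace Ω] (P : Measure Ω) (α : ℕ → ℝ)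
    (ε : ℤ → Ω → ℝ) : Prop :=
  ∃ c : ℝ, 0 < c ∧ ∀ n : ℕ, 1 ≤ n → c * rate α n ≤ normalDistance P α ε n

end

/-!
The partial sum is a weighted sum `S_n = ∑_i b_i ε_i` of independent innovations, where
`b_i = ∑_{1 ≤ k ≤ n} α_{k-i}`, so that `|b_i| ≤ ∑_j |α_j|` and `∑_i b_i = n ∑_j α_j`.

Stein's method, with a concentration inequality for the sum of all innovations but one, gives the
Berry–Esseen bound `E|ε_0|³ ∑_i |b_i|³ / v^{3/2}` with `v = ∑_i b_i ^ 2` up to a constant; this is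
of order `n^{-1/2}` as soon as `v` is of order `n`. Replacing `v` by `n s²` is a change of scale,
which costs at most of order `|n s² - v| / (n s²)`. With `a = ∑_j α_j`,
`n s² - v = ∑_i b_i (a - b_i)`, and the innovations with `1 ≤ i ≤ n` as well as those with `i ≤ 0`
contribute at most of order `∑_j min(j, n) |α_j| = n R_n`. If `R_n` is not small, the bound holds
trivially.

For Gaussian innovations there is no Berry–Esseen error, and for non-negative coefficients
`n s² - v` is at least `α_0 n R_n`, so `R_n` is also a lower bound. For random signs and `X_k = ε_k`
the partial sum has no mass in `(0, 1/2]`, which forces an error of order `n^{-1/2}`.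
-/

noncomputable section

open Set Topology

/-! ### The standard normal law -/

/-- The density of the standard normal law, which appears in Stein's equation. -/
def stdPDF (x : ℝ) : ℝ := gaussianPDFReal 0 1 x

/-- The distribution function `Φ` of the standard normal law. -/
def stdCDF (x : ℝ) : ℝ := cdf (gaussianReal 0 1) x

lemma stdPDF_eq (x : ℝ) : stdPDF x = (√(2 * Real.pi))⁻¹ * Real.exp (-x ^ 2 / 2) := by
  simp [stdPDF, gaussianPDFReal]

lemma stdPDF_pos (x : ℝ) : 0 < stdPDF x := gaussianPDFReal_pos 0 1 x one_ne_zero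

lemma stdPDF_neg (x : ℝ) : stdPDF (-x) = stdPDF x := by simp only [stdPDF_eq, neg_sq]

lemma stdPDF_le_of_abs_le {x y : ℝ} (h : |x| ≤ |y|) : stdPDF y ≤ stdPDF x := by
  rw [stdPDF_eq, stdPDF_eq]
  have := sq_le_sq.2 h
  gcongr

lemma hasDerivAt_stdPDF (x : ℝ) : HasDerivAt stdPDF (-x * stdPDF x) x := by
  have h_exponent : HasDerivAt (fun x : ℝ => -x ^ 2 / 2) (-x) x :=
    ((hasDerivAt_pow 2 x).neg.div_const 2).congr_deriv (by ring)
  rw [funext stdPDF_eq]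
  exact (h_exponent.exp.const_mul _).congr_deriv (by ring)

lemma continuous_stdPDF : Continuous stdPDF :=
  continuous_iff_continuousAt.2 fun x => (hasDerivAt_stdPDF x).continuousAt

lemma integrable_stdPDF : Integrable stdPDF := integrable_gaussianPDFReal 0 1

lemma tendsto_stdPDF_atTop : Tendsto stdPDF atTop (𝓝 0) := by
  have h_exponent : Tendsto (fun x : ℝ => -x ^ 2 / 2) atTop atBot := by
    simp_rw [neg_div]
    exact tendsto_neg_atTop_atBot.comp
      ((tendsto_pow_atTop two_ne_zero).atTop_div_const two_pos)
  rw [funext stdPDF_eq]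
  simpa using (Real.tendsto_exp_atBot.comp h_exponent).const_mul (√(2 * Real.pi))⁻¹

lemma two_le_sqrt_two_pi : 2 ≤ √(2 * Real.pi) :=
  Real.le_sqrt_of_sq_le (by linarith [Real.pi_gt_three])

lemma stdPDF_le_half_mul_exp (x : ℝ) : stdPDF x ≤ 1 / 2 * Real.exp (-x ^ 2 / 2) := by
  rw [stdPDF_eq, one_div]
  gcongr
  exact two_le_sqrt_two_pi

lemma one_fifth_le_stdPDF {x : ℝ} (hx : |x| ≤ 1) : 1 / 5 ≤ stdPDF x := by
  have h_sqrt : √(2 * Real.pi) ≤ 2.6 := by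
    rw [Real.sqrt_le_left (by norm_num)]
    nlinarith [Real.pi_lt_d2]
  have h_exp : (0.55 : ℝ) ≤ Real.exp (-1 ^ 2 / 2) := by
    have := Real.one_sub_div_pow_le_exp_neg (n := 2) (t := 1 / 2) (by norm_num)
    norm_num at this ⊢
    linarith
  calc (1 / 5 : ℝ) ≤ (2.6 : ℝ)⁻¹ * 0.55 := by norm_num
    _ ≤ (√(2 * Real.pi))⁻¹ * Real.exp (-1 ^ 2 / 2) := by gcongr
    _ = stdPDF 1 := (stdPDF_eq 1).symm
    _ ≤ stdPDF x := stdPDF_le_of_abs_le (by rwa [abs_one])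

lemma stdCDF_nonneg (x : ℝ) : 0 ≤ stdCDF x := cdf_nonneg _ x

lemma stdCDF_le_one (x : ℝ) : stdCDF x ≤ 1 := cdf_le_one _ x

lemma monotone_stdCDF : Monotone stdCDF := monotone_cdf _

lemma stdCDF_eq_integral (x : ℝ) : stdCDF x = ∫ t in Iic x, stdPDF t := by
  rw [stdCDF, cdf_eq_real, Measure.real, gaussianReal_apply_eq_integral _ one_ne_zero]
  exact ENNReal.toReal_ofReal (integral_nonneg fun t => gaussianPDFReal_nonneg 0 1 t)

lemma hasDerivAt_stdCDF (x : ℝ) : HasDerivAt stdCDF (stdPDF x) x := by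
  have h_sub (y : ℝ) : stdCDF y = (∫ t in (0 : ℝ)..y, stdPDF t) + stdCDF 0 := by
    rw [stdCDF_eq_integral, stdCDF_eq_integral, ← intervalIntegral.integral_Iic_sub_Iic
      integrable_stdPDF.integrableOn integrable_stdPDF.integrableOn, sub_add_cancel]
  rw [funext h_sub]
  exact (intervalIntegral.integral_hasDerivAt_right (continuous_stdPDF.intervalIntegrable _ _)
    (continuous_stdPDF.stronglyMeasurableAtFilter _ _) continuous_stdPDF.continuousAt).add_const _

lemma continuous_stdCDF : Continuous stdCDF :=
  continuous_iff_continuousAt.2 fun x => (hasDerivAt_stdCDF x).continuousAt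

lemma one_sub_stdCDF_eq_integral (x : ℝ) : 1 - stdCDF x = ∫ t in Ioi x, stdPDF t :=
  (integral_Ioi_of_hasDerivAt_of_nonneg' (fun t _ => hasDerivAt_stdCDF t)
    (fun t _ => (stdPDF_pos t).le) (tendsto_cdf_atTop _)).symm

lemma stdCDF_neg (x : ℝ) : stdCDF (-x) = 1 - stdCDF x := by
  rw [one_sub_stdCDF_eq_integral, stdCDF_eq_integral]
  simpa only [stdPDF_neg, neg_neg] using integral_comp_neg_Iic (-x) stdPDF

lemma mul_one_sub_stdCDF_le_stdPDF (x : ℝ) : x * (1 - stdCDF x) ≤ stdPDF x := by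
  rcases le_or_gt x 0 with hx | hx
  · exact (mul_nonpos_of_nonpos_of_nonneg hx (sub_nonneg.2 (stdCDF_le_one x))).trans
      (stdPDF_pos x).le
  have h_deriv : ∀ t ∈ Ici x, HasDerivAt (-stdPDF) (t * stdPDF t) t := fun t _ =>
    (hasDerivAt_stdPDF t).neg.congr_deriv (by ring)
  have h_nonneg : ∀ t ∈ Ioi x, 0 ≤ t * stdPDF t := fun t ht =>
    mul_nonneg (hx.trans ht).le (stdPDF_pos t).le
  have h_lim : Tendsto (-stdPDF) atTop (𝓝 0) := neg_zero (G := ℝ) ▸ tendsto_stdPDF_atTop.neg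
  calc x * (1 - stdCDF x) = ∫ t in Ioi x, x * stdPDF t := by
        rw [one_sub_stdCDF_eq_integral, integral_const_mul]
    _ ≤ ∫ t in Ioi x, t * stdPDF t :=
        setIntegral_mono_on (integrable_stdPDF.integrableOn.const_mul x)
          (integrableOn_Ioi_deriv_of_nonneg' h_deriv h_nonneg h_lim) measurableSet_Ioi
          fun t ht => mul_le_mul_of_nonneg_right (le_of_lt ht) (stdPDF_pos t).le
    _ = stdPDF x := by
        simpa using integral_Ioi_of_hasDerivAt_of_nonneg' h_deriv h_nonneg h_lim

lemma mul_sub_le_stdCDF_sub {x y m : ℝ} (hxy : x ≤ y) (hm : ∀ t ∈ Icc x y, m ≤ stdPDF t) :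
    m * (y - x) ≤ stdCDF y - stdCDF x :=
  (convex_Icc x y).mul_sub_le_image_sub_of_le_deriv continuous_stdCDF.continuousOn
    (fun t _ => (hasDerivAt_stdCDF t).differentiableAt.differentiableWithinAt)
    (fun t ht => (hasDerivAt_stdCDF t).deriv ▸ hm t (interior_subset ht))
    x (left_mem_Icc.2 hxy) y (right_mem_Icc.2 hxy) hxy

lemma abs_stdCDF_sub_le {x y M : ℝ} (hM : ∀ t ∈ uIcc x y, stdPDF t ≤ M) :
    |stdCDF y - stdCDF x| ≤ M * |y - x| :=
  (convex_uIcc x y).norm_image_sub_le_of_norm_hasDerivWithin_le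
    (fun t _ => (hasDerivAt_stdCDF t).hasDerivWithinAt)
    (fun t ht => (abs_of_pos (stdPDF_pos t)).trans_le (hM t ht)) left_mem_uIcc right_mem_uIcc

lemma abs_mul_exp_neg_sq_div_eight_le (t : ℝ) : |t| * Real.exp (-(t ^ 2 / 8)) ≤ 2 := by
  have h_le : |t| ≤ 2 * Real.exp (t ^ 2 / 8) := by
    have := Real.add_one_le_exp (t ^ 2 / 8)
    nlinarith [sq_nonneg (|t| - 2), sq_abs t]
  rwa [Real.exp_neg, ← div_eq_mul_inv, div_le_iff₀ (Real.exp_pos _)]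

lemma abs_stdCDF_mul_sub_le (t : ℝ) {c : ℝ} (hc : 1 / 2 ≤ c) :
    |stdCDF (c * t) - stdCDF t| ≤ |c - 1| := by
  have h_half_le {u : ℝ} (hu : u ∈ uIcc t (c * t)) : |t / 2| ≤ |u| := by
    rcases le_total 0 t with ht | ht
    · have : t / 2 ≤ c * t := by nlinarith
      rw [mem_uIcc] at hu
      exact abs_le_abs_of_nonneg (by linarith) (by rcases hu with hu | hu <;> linarith [hu.1])
    · have : c * t ≤ t / 2 := by nlinarith
      rw [mem_uIcc] at hu
      exact abs_le_abs_of_nonpos (by linarith) (by rcases hu with hu | hu <;> linarith [hu.2])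
  have h_pdf {u : ℝ} (hu : u ∈ uIcc t (c * t)) :
      stdPDF u ≤ 1 / 2 * Real.exp (-(t ^ 2 / 8)) :=
    calc stdPDF u ≤ stdPDF (t / 2) := stdPDF_le_of_abs_le (h_half_le hu)
      _ ≤ 1 / 2 * Real.exp (-(t / 2) ^ 2 / 2) := stdPDF_le_half_mul_exp _
      _ = 1 / 2 * Real.exp (-(t ^ 2 / 8)) := by ring_nf
  calc |stdCDF (c * t) - stdCDF t|
      ≤ 1 / 2 * Real.exp (-(t ^ 2 / 8)) * |c * t - t| := abs_stdCDF_sub_le fun _ => h_pdf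
    _ = |c - 1| * (|t| * Real.exp (-(t ^ 2 / 8)) / 2) := by
        rw [show c * t - t = (c - 1) * t by ring, abs_mul]; ring
    _ ≤ |c - 1| * 1 := by
        gcongr
        linarith [abs_mul_exp_neg_sq_div_eight_le t]
    _ = |c - 1| := mul_one _

lemma abs_stdCDF_div_sqrt_sub_le {v w : ℝ} (hw : 0 < w) (hwv : w / 2 ≤ v) (hvw : v ≤ 2 * w)
    (y : ℝ) : |stdCDF (y / √v) - stdCDF (y / √w)| ≤ 2 * |v / w - 1| := by
  have hv : 0 < v := by linarith
  have hsv : 0 < √v := Real.sqrt_pos.2 hv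
  have hsw : 0 < √w := Real.sqrt_pos.2 hw
  have h_sq : (√w / √v) ^ 2 = w / v := by rw [div_pow, Real.sq_sqrt hw.le, Real.sq_sqrt hv.le]
  have h_half : 1 / 2 ≤ √w / √v := by
    have : 1 / 2 ≤ w / v := by rw [le_div_iff₀ hv]; linarith
    nlinarith [div_pos hsw hsv]
  have h_two : w / v ≤ 2 := by rw [div_le_iff₀ hv]; linarith
  calc |stdCDF (y / √v) - stdCDF (y / √w)|
      = |stdCDF (√w / √v * (y / √w)) - stdCDF (y / √w)| := by
        rw [show √w / √v * (y / √w) = y / √v by field_simp]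
    _ ≤ |√w / √v - 1| := abs_stdCDF_mul_sub_le _ h_half
    _ ≤ |√w / √v - 1| * |√w / √v + 1| :=
        le_mul_of_one_le_right (abs_nonneg _) (le_abs.2 (Or.inl (by linarith)))
    _ = |w / v - 1| := by rw [← abs_mul, ← h_sq]; ring_nf
    _ = w / v * |v / w - 1| := by
        rw [← abs_of_pos (div_pos hw hv), ← abs_mul, abs_of_pos (div_pos hw hv), abs_sub_comm]
        congr 1
        field_simp
    _ ≤ 2 * |v / w - 1| := by gcongr

lemma gaussianReal_real_Iic {v : NNReal} (hv : v ≠ 0) (y : ℝ) :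
    (gaussianReal 0 v).real (Iic y) = stdCDF (y / √v) := by
  have hsv : 0 < √(v : ℝ) := Real.sqrt_pos.2 (by positivity)
  have h_scale : (gaussianReal 0 1).map (√(v : ℝ) * ·) = gaussianReal 0 v := by
    rw [gaussianReal_map_const_mul, mul_zero]
    congr 1
    ext
    simp
  have h_preimage : (√(v : ℝ) * ·) ⁻¹' Iic y = Iic (y / √v) := by
    ext x
    simp only [mem_preimage, mem_Iic, le_div_iff₀ hsv, mul_comm]
  rw [← h_scale, map_measureReal_apply (by fun_prop) measurableSet_Iic, h_preimage, stdCDF,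
    cdf_eq_real]

/-! ### Stein's equation -/

/-- The bounded solution `f` of Stein's equation `f' w - w * f w = 1_{w ≤ z} - Φ z`, equal to
`Φ (1 - Φ z) / φ` to the left of `z` and to `Φ z (1 - Φ) / φ` to the right of it. -/
def steinSol (z w : ℝ) : ℝ := (stdPDF w)⁻¹ * (stdCDF (min w z) * (1 - stdCDF (max w z)))

/-- The derivative of the Stein solution, as prescribed by Stein's equation also at `w = z`, where
the Stein solution has a corner. -/
def steinDeriv (z w : ℝ) : ℝ :=
  w * steinSol z w + (if w ≤ z then 1 else 0) - stdCDF z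

lemma continuous_steinSol (z : ℝ) : Continuous (steinSol z) :=
  (continuous_stdPDF.inv₀ fun w => (stdPDF_pos w).ne').mul
    ((continuous_stdCDF.comp (continuous_id.min continuous_const)).mul
      (continuous_const.sub (continuous_stdCDF.comp (continuous_id.max continuous_const))))

lemma measurable_steinDeriv (z : ℝ) : Measurable (steinDeriv z) :=
  ((measurable_id.mul (continuous_steinSol z).measurable).add
    (Measurable.ite measurableSet_Iic measurable_const measurable_const)).sub measurable_const

lemma steinSol_nonneg (z w : ℝ) : 0 ≤ steinSol z w :=
  mul_nonneg (inv_nonneg.2 (stdPDF_pos w).le)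
    (mul_nonneg (stdCDF_nonneg _) (sub_nonneg.2 (stdCDF_le_one _)))

lemma steinSol_le_stdCDF_div (z w : ℝ) : steinSol z w ≤ stdCDF w / stdPDF w := by
  have h_min := monotone_stdCDF (min_le_left w z)
  rw [div_eq_inv_mul]
  refine mul_le_mul_of_nonneg_left ?_ (inv_nonneg.2 (stdPDF_pos w).le)
  nlinarith [stdCDF_nonneg (min w z), stdCDF_nonneg (max w z)]

lemma steinSol_le_one_sub_stdCDF_div (z w : ℝ) : steinSol z w ≤ (1 - stdCDF w) / stdPDF w := by
  have h_max := monotone_stdCDF (le_max_left w z)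
  rw [div_eq_inv_mul]
  refine mul_le_mul_of_nonneg_left ?_ (inv_nonneg.2 (stdPDF_pos w).le)
  nlinarith [stdCDF_le_one (min w z), stdCDF_le_one (max w z)]

lemma abs_mul_steinSol_le_one (z w : ℝ) : |w * steinSol z w| ≤ 1 := by
  rw [abs_mul, abs_of_nonneg (steinSol_nonneg z w)]
  rcases le_total 0 w with hw | hw
  · calc |w| * steinSol z w ≤ w * ((1 - stdCDF w) / stdPDF w) := by
          rw [abs_of_nonneg hw]
          exact mul_le_mul_of_nonneg_left (steinSol_le_one_sub_stdCDF_div z w) hw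
      _ = w * (1 - stdCDF w) / stdPDF w := (mul_div_assoc _ _ _).symm
      _ ≤ 1 := (div_le_one (stdPDF_pos w)).2 (mul_one_sub_stdCDF_le_stdPDF w)
  · have h_mills : -w * stdCDF w ≤ stdPDF w := by
      simpa [stdCDF_neg, stdPDF_neg] using mul_one_sub_stdCDF_le_stdPDF (-w)
    calc |w| * steinSol z w ≤ -w * (stdCDF w / stdPDF w) := by
          rw [abs_of_nonpos hw]
          exact mul_le_mul_of_nonneg_left (steinSol_le_stdCDF_div z w) (neg_nonneg.2 hw)
      _ = -w * stdCDF w / stdPDF w := (mul_div_assoc _ _ _).symm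
      _ ≤ 1 := (div_le_one (stdPDF_pos w)).2 h_mills

lemma abs_steinSol_le (z w : ℝ) : |steinSol z w| ≤ 5 := by
  rcases le_total |w| 1 with hw | hw
  · calc |steinSol z w| = steinSol z w := abs_of_nonneg (steinSol_nonneg z w)
      _ ≤ stdCDF w / stdPDF w := steinSol_le_stdCDF_div z w
      _ ≤ 1 / (1 / 5) := by
        gcongr
        exacts [stdCDF_le_one w, one_fifth_le_stdPDF hw]
      _ = 5 := by norm_num
  · have := abs_mul_steinSol_le_one z w
    rw [abs_mul] at this
    nlinarith [abs_nonneg (steinSol z w)]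

lemma abs_mul_steinSol_add_sub_le (z w : ℝ) {a : ℝ} (ha : a ∈ Icc (0 : ℝ) 1) :
    |w * steinSol z w + a - stdCDF z| ≤ 2 := by
  have h_mul := abs_le.1 (abs_mul_steinSol_le_one z w)
  rw [abs_le]
  constructor <;> linarith [h_mul.1, h_mul.2, ha.1, ha.2, stdCDF_nonneg z, stdCDF_le_one z]

lemma abs_steinDeriv_le (z w : ℝ) : |steinDeriv z w| ≤ 2 :=
  abs_mul_steinSol_add_sub_le z w (by split_ifs <;> simp)

lemma hasDerivAt_inv_stdPDF (w : ℝ) :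
    HasDerivAt (fun w => (stdPDF w)⁻¹) (w * (stdPDF w)⁻¹) w := by
  have hp := (stdPDF_pos w).ne'
  refine ((hasDerivAt_stdPDF w).inv hp).congr_deriv ?_
  field_simp

lemma hasDerivAt_inv_stdPDF_mul_stdCDF (z w : ℝ) :
    HasDerivAt (fun w => (stdPDF w)⁻¹ * (stdCDF w * (1 - stdCDF z)))
      (w * ((stdPDF w)⁻¹ * (stdCDF w * (1 - stdCDF z))) + 1 - stdCDF z) w := by
  have hp := (stdPDF_pos w).ne'
  refine ((hasDerivAt_inv_stdPDF w).mul
    ((hasDerivAt_stdCDF w).mul_const (1 - stdCDF z))).congr_deriv ?_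
  field_simp
  ring

lemma hasDerivAt_inv_stdPDF_mul_one_sub_stdCDF (z w : ℝ) :
    HasDerivAt (fun w => (stdPDF w)⁻¹ * (stdCDF z * (1 - stdCDF w)))
      (w * ((stdPDF w)⁻¹ * (stdCDF z * (1 - stdCDF w))) - stdCDF z) w := by
  have hp := (stdPDF_pos w).ne'
  refine ((hasDerivAt_inv_stdPDF w).mul
    (((hasDerivAt_stdCDF w).const_sub 1).const_mul (stdCDF z))).congr_deriv ?_
  field_simp
  ring

lemma steinSol_of_le {z w : ℝ} (h : w ≤ z) :
    steinSol z w = (stdPDF w)⁻¹ * (stdCDF w * (1 - stdCDF z)) := by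
  rw [steinSol, min_eq_left h, max_eq_right h]

lemma steinSol_of_ge {z w : ℝ} (h : z ≤ w) :
    steinSol z w = (stdPDF w)⁻¹ * (stdCDF z * (1 - stdCDF w)) := by
  rw [steinSol, min_eq_right h, max_eq_left h]

lemma hasDerivAt_steinSol {z w : ℝ} (h : w ≠ z) :
    HasDerivAt (steinSol z) (steinDeriv z w) w := by
  rcases lt_or_gt_of_ne h with h | h
  · have h_eq : steinSol z =ᶠ[𝓝 w] fun w => (stdPDF w)⁻¹ * (stdCDF w * (1 - stdCDF z)) := by
      filter_upwards [Iio_mem_nhds h] with y hy using steinSol_of_le (le_of_lt hy)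
    refine ((hasDerivAt_inv_stdPDF_mul_stdCDF z w).congr_of_eventuallyEq h_eq).congr_deriv ?_
    simp only [steinDeriv, h.le, if_true, steinSol_of_le]
  · have h_eq : steinSol z =ᶠ[𝓝 w] fun w => (stdPDF w)⁻¹ * (stdCDF z * (1 - stdCDF w)) := by
      filter_upwards [Ioi_mem_nhds h] with y hy using steinSol_of_ge (le_of_lt hy)
    refine ((hasDerivAt_inv_stdPDF_mul_one_sub_stdCDF z w).congr_of_eventuallyEq
      h_eq).congr_deriv ?_
    rw [steinDeriv, if_neg (not_le.2 h), add_zero, steinSol_of_ge h.le]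

lemma hasDerivWithinAt_steinSol_self (z : ℝ) :
    HasDerivWithinAt (steinSol z) (z * steinSol z z - stdCDF z) (Ici z) z := by
  rw [steinSol_of_ge le_rfl]
  exact (hasDerivAt_inv_stdPDF_mul_one_sub_stdCDF z z).hasDerivWithinAt.congr
    (fun y hy => steinSol_of_ge hy) (steinSol_of_ge le_rfl)

lemma abs_steinSol_sub_le (z a b : ℝ) : |steinSol z b - steinSol z a| ≤ 2 * |b - a| := by
  wlog hab : a ≤ b generalizing a b
  · rw [abs_sub_comm, abs_sub_comm b]
    exact this b a (le_of_not_ge hab)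
  have h_deriv (w : ℝ) : ∃ d, HasDerivWithinAt (steinSol z) d (Ici w) w ∧ ‖d‖ ≤ 2 := by
    rcases eq_or_ne w z with rfl | h
    · exact ⟨_, hasDerivWithinAt_steinSol_self w,
        by simpa using abs_mul_steinSol_add_sub_le w w (a := 0) (by simp)⟩
    · exact ⟨_, (hasDerivAt_steinSol h).hasDerivWithinAt, abs_steinDeriv_le z w⟩
  choose d hd hd_le using h_deriv
  simpa only [Real.norm_eq_abs, abs_of_nonneg (sub_nonneg.2 hab)] using
    norm_image_sub_le_of_norm_deriv_right_le_segment (continuous_steinSol z).continuousOn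
      (fun w _ => hd w) (fun w _ => hd_le w) b (right_mem_Icc.2 hab)

lemma abs_mul_steinSol_sub_le (z w t : ℝ) :
    |(w + t) * steinSol z (w + t) - w * steinSol z w| ≤ |t| * (5 + 2 * |w|) := by
  have h_lip : |steinSol z (w + t) - steinSol z w| ≤ 2 * |t| := by
    simpa using abs_steinSol_sub_le z w (w + t)
  calc |(w + t) * steinSol z (w + t) - w * steinSol z w|
      = |t * steinSol z (w + t) + w * (steinSol z (w + t) - steinSol z w)| := by ring_nf
    _ ≤ |t| * |steinSol z (w + t)| + |w| * |steinSol z (w + t) - steinSol z w| := by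
        rw [← abs_mul, ← abs_mul]
        exact abs_add_le _ _
    _ ≤ |t| * 5 + |w| * (2 * |t|) := by
        gcongr
        exact abs_steinSol_le z _
    _ = |t| * (5 + 2 * |w|) := by ring

lemma abs_steinDeriv_sub_le_of_lt {z w u : ℝ} (h : |u| < |w - z|) :
    |steinDeriv z (w + u) - steinDeriv z w| ≤ |u| * (5 + 2 * |w|) := by
  have h_same_side : w + u ≤ z ↔ w ≤ z := by
    have hu := abs_lt.1 h
    rcases abs_cases (w - z) with hw | hw <;> constructor <;> intro <;> linarith [hu.1, hu.2]
  calc |steinDeriv z (w + u) - steinDeriv z w|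
      = |(w + u) * steinSol z (w + u) - w * steinSol z w| := by
        simp only [steinDeriv, h_same_side]
        ring_nf
    _ ≤ |u| * (5 + 2 * |w|) := abs_mul_steinSol_sub_le z w u

lemma abs_steinDeriv_sub_le (z w u : ℝ) :
    |steinDeriv z (w + u) - steinDeriv z w|
      ≤ |u| * (5 + 2 * |w|) + 4 * (if |w - z| ≤ |u| then 1 else 0) := by
  split_ifs with h
  · have h_sub := abs_sub (steinDeriv z (w + u)) (steinDeriv z w)
    have : 0 ≤ |u| * (5 + 2 * |w|) := by positivity
    linarith [abs_steinDeriv_le z (w + u), abs_steinDeriv_le z w]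
  · simpa using abs_steinDeriv_sub_le_of_lt (not_le.1 h)

lemma abs_steinSol_taylor_le_of_lt {z w u : ℝ} (h : |u| < |w - z|) :
    |steinSol z (w + u) - steinSol z w - u * steinDeriv z w| ≤ |u| * (|u| * (5 + 2 * |w|)) := by
  have h_near {t : ℝ} (ht : t ∈ uIcc w (w + u)) : |t - w| ≤ |u| := by
    simpa using abs_sub_left_of_mem_uIcc ht
  have h_deriv : ∀ t ∈ uIcc w (w + u),
      HasDerivWithinAt (fun t => steinSol z t - t * steinDeriv z w)
        (steinDeriv z t - steinDeriv z w) (uIcc w (w + u)) t := fun t ht => by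
    have h_ne : t ≠ z := by
      rintro rfl
      exact absurd (h_near ht) (by rw [abs_sub_comm]; exact not_le.2 h)
    have h_linear := (hasDerivAt_id t).mul_const (steinDeriv z w)
    exact (((hasDerivAt_steinSol h_ne).sub h_linear).congr_deriv
      (by rw [one_mul])).hasDerivWithinAt
  have h_bound : ∀ t ∈ uIcc w (w + u),
      ‖steinDeriv z t - steinDeriv z w‖ ≤ |u| * (5 + 2 * |w|) := fun t ht => by
    have h_sub := abs_steinDeriv_sub_le_of_lt ((h_near ht).trans_lt h)
    rw [add_sub_cancel] at h_sub
    exact h_sub.trans (mul_le_mul_of_nonneg_right (h_near ht) (by positivity))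
  have h_image := (convex_uIcc w (w + u)).norm_image_sub_le_of_norm_hasDerivWithin_le
    h_deriv h_bound left_mem_uIcc right_mem_uIcc
  rw [Real.norm_eq_abs, Real.norm_eq_abs, add_sub_cancel_left] at h_image
  convert h_image using 1
  · ring_nf
  · ring

lemma abs_steinSol_taylor_le (z w u : ℝ) :
    |steinSol z (w + u) - steinSol z w - u * steinDeriv z w|
      ≤ |u| * (|u| * (5 + 2 * |w|) + 4 * (if |w - z| ≤ |u| then 1 else 0)) := by
  split_ifs with h
  · have h_lip : |steinSol z (w + u) - steinSol z w| ≤ 2 * |u| := by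
      simpa using abs_steinSol_sub_le z w (w + u)
    have h_sub := abs_sub (steinSol z (w + u) - steinSol z w) (u * steinDeriv z w)
    rw [abs_mul] at h_sub
    have : 0 ≤ |u| * (|u| * (5 + 2 * |w|)) := by positivity
    nlinarith [abs_nonneg u, abs_steinDeriv_le z w]
  · simpa using abs_steinSol_taylor_le_of_lt (not_le.1 h)

/-- A bound for the error committed when a summand `x` of variance `v` is added to `w` in Stein's
identity; the indicator accounts for the jump of `steinDeriv z` at `z`. -/
def steinBound (z v x w : ℝ) : ℝ :=
  (v + x ^ 2) * (|x| * (5 + 2 * |w|) + 4 * (if |w - z| ≤ |x| then 1 else 0))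

lemma abs_stein_remainder_le (z w x : ℝ) {v : ℝ} (hv : 0 ≤ v) :
    |v * (steinDeriv z (w + x) - steinDeriv z w)
        - x * (steinSol z (w + x) - steinSol z w - x * steinDeriv z w)| ≤ steinBound z v x w := by
  rw [steinBound]
  refine (abs_sub _ _).trans ?_
  rw [abs_mul, abs_of_nonneg hv, abs_mul, ← sq_abs x]
  have h_deriv := mul_le_mul_of_nonneg_left (abs_steinDeriv_sub_le z w x) hv
  have h_taylor := mul_le_mul_of_nonneg_left (abs_steinSol_taylor_le z w x) (abs_nonneg x)
  linarith

/-! ### Concentration of sums of independent variables -/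

section Moments

variable {Ω : Type*} [MeasurableSpace Ω] {P : Measure Ω} {X Y : Ω → ℝ}

lemma integrable_abs_pow_three (hX : MemLp X 3 P) : Integrable (fun ω => |X ω| ^ 3) P := by
  simpa [Real.norm_eq_abs] using hX.integrable_norm_pow (p := 3) (by norm_num)

lemma memLp_three_of_integrable (hX : AEStronglyMeasurable X P)
    (h : Integrable (fun ω => |X ω| ^ 3) P) : MemLp X 3 P := by
  refine (integrable_norm_rpow_iff hX (by norm_num) (by norm_num)).1 ?_
  simpa using h

lemma memLp_two_of_memLp_three [IsFiniteMeasure P] (hX : MemLp X 3 P) : MemLp X 2 P :=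
  hX.mono_exponent (by norm_num)

lemma integral_abs_le_of_integral_sq_le [IsProbabilityMeasure P] (hX : MemLp X 2 P) {c : ℝ}
    (hc : 0 ≤ c) (h : ∫ ω, X ω ^ 2 ∂P ≤ c ^ 2) : ∫ ω, |X ω| ∂P ≤ c := by
  have h_var : 0 ≤ ∫ ω, X ω ^ 2 ∂P - (∫ ω, |X ω| ∂P) ^ 2 := by
    simpa [variance_eq_sub hX.abs] using variance_nonneg |X| P
  exact le_of_sq_le_sq (by linarith) hc

lemma integral_sq_mul_integral_abs_le [IsProbabilityMeasure P] (hX : MemLp X 3 P) :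
    (∫ ω, X ω ^ 2 ∂P) * ∫ ω, |X ω| ∂P ≤ ∫ ω, |X ω| ^ 3 ∂P := by
  set c := ∫ ω, |X ω| ∂P with hc
  have h_abs : Integrable (fun ω => |X ω|) P := (hX.integrable (by norm_num)).abs
  have h_sq : Integrable (fun ω => X ω ^ 2) P := (memLp_two_of_memLp_three hX).integrable_sq
  have hc0 : 0 ≤ c := integral_nonneg fun ω => abs_nonneg _
  -- `(|x| + c) (|x| - c) ^ 2 ≥ 0`
  have h_pointwise (ω : Ω) : X ω ^ 2 * c + c ^ 2 * |X ω| - c ^ 3 ≤ |X ω| ^ 3 := by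
    rw [← sq_abs (X ω)]
    nlinarith [mul_nonneg (add_nonneg (abs_nonneg (X ω)) hc0) (sq_nonneg (|X ω| - c))]
  have h_add : Integrable (fun ω => X ω ^ 2 * c + c ^ 2 * |X ω|) P :=
    (h_sq.mul_const c).add (h_abs.const_mul (c ^ 2))
  calc (∫ ω, X ω ^ 2 ∂P) * c = (∫ ω, X ω ^ 2 ∂P) * c + c ^ 2 * c - c ^ 3 := by ring
    _ = ∫ ω, (X ω ^ 2 * c + c ^ 2 * |X ω| - c ^ 3) ∂P := by
        rw [integral_sub h_add (integrable_const _), integral_add (h_sq.mul_const c)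
          (h_abs.const_mul _), integral_mul_const, integral_const_mul, integral_const, ← hc,
          probReal_univ, one_smul]
    _ ≤ ∫ ω, |X ω| ^ 3 ∂P :=
        integral_mono (h_add.sub (integrable_const _)) (integrable_abs_pow_three hX) h_pointwise

lemma sq_le_quarter_add_two_mul_abs_pow_three (x : ℝ) : x ^ 2 ≤ 1 / 4 + 2 * |x| ^ 3 := by
  rw [← sq_abs x]
  rcases le_total |x| (1 / 2) with h | h
  · have : 0 ≤ |x| ^ 3 := by positivity
    nlinarith [abs_nonneg x]
  · nlinarith [mul_nonneg (sq_nonneg |x|) (sub_nonneg.2 h)]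

lemma integral_sq_le_quarter_add [IsProbabilityMeasure P] (hX : MemLp X 3 P) :
    ∫ ω, X ω ^ 2 ∂P ≤ 1 / 4 + 2 * ∫ ω, |X ω| ^ 3 ∂P := by
  have h_cube := (integrable_abs_pow_three hX).const_mul 2
  calc ∫ ω, X ω ^ 2 ∂P ≤ ∫ ω, (1 / 4 + 2 * |X ω| ^ 3) ∂P :=
        integral_mono (memLp_two_of_memLp_three hX).integrable_sq
          ((integrable_const _).add h_cube)
          fun ω => sq_le_quarter_add_two_mul_abs_pow_three (X ω)
    _ = 1 / 4 + 2 * ∫ ω, |X ω| ^ 3 ∂P := by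
        rw [integral_add (integrable_const _) h_cube, integral_const_mul, integral_const,
          probReal_univ, one_smul]

lemma integral_comp_le_of_indepFun [IsFiniteMeasure P] (hXY : IndepFun X Y P)
    (hX : AEMeasurable X P) (hY : AEMeasurable Y P) {G : ℝ × ℝ → ℝ} (hG : Measurable G)
    (hG_int : Integrable (fun ω => G (X ω, Y ω)) P) {H : ℝ → ℝ} (hH : Measurable H)
    (hH_int : Integrable (fun ω => H (X ω)) P) (h : ∀ x, ∫ ω, G (x, Y ω) ∂P ≤ H x) :
    ∫ ω, G (X ω, Y ω) ∂P ≤ ∫ ω, H (X ω) ∂P := by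
  have h_law := (indepFun_iff_map_prod_eq_prod_map_map hX hY).1 hXY
  have h_int : Integrable G ((P.map X).prod (P.map Y)) := by
    rw [← h_law]
    exact (integrable_map_measure hG.aestronglyMeasurable (hX.prodMk hY)).2 hG_int
  calc ∫ ω, G (X ω, Y ω) ∂P = ∫ p, G p ∂(P.map fun ω => (X ω, Y ω)) :=
        (integral_map (hX.prodMk hY) hG.aestronglyMeasurable).symm
    _ = ∫ x, ∫ y, G (x, y) ∂(P.map Y) ∂(P.map X) := by rw [h_law, integral_prod _ h_int]
    _ ≤ ∫ x, H x ∂(P.map X) := by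
        refine integral_mono h_int.integral_prod_left
          ((integrable_map_measure hH.aestronglyMeasurable hX).2 hH_int) fun x => ?_
        exact (integral_map hY (hG.comp measurable_prodMk_left).aestronglyMeasurable).trans_le
          (h x)
    _ = ∫ ω, H (X ω) ∂P := integral_map hX hH.aestronglyMeasurable

end Moments

section IndependentSums

variable {Ω : Type*} [MeasurableSpace Ω] {P : Measure Ω} {ι : Type*} {ξ : ι → Ω → ℝ}

lemma indepFun_sum_erase [DecidableEq ι] (hI : iIndepFun ξ P) (hm : ∀ i, AEMeasurable (ξ i) P)
    (s : Finset ι) (i : ι) : IndepFun (ξ i) (fun ω => ∑ j ∈ s.erase i, ξ j ω) P := by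
  simpa only [Finset.sum_fn] using
    (hI.indepFun_finsetSum_of_notMem₀ hm (s.notMem_erase i)).symm

lemma integral_mul_comp_sum_erase_eq_zero [DecidableEq ι] (hI : iIndepFun ξ P)
    (hm : ∀ i, AEMeasurable (ξ i) P) (s : Finset ι) {i : ι} (h0 : ∫ ω, ξ i ω ∂P = 0)
    {ψ : ℝ → ℝ} (hψ : Measurable ψ) :
    ∫ ω, ξ i ω * ψ (∑ j ∈ s.erase i, ξ j ω) ∂P = 0 := by
  have h_factor := (indepFun_sum_erase hI hm s i).integral_fun_comp_mul_comp (hm i)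
    (Finset.aemeasurable_fun_sum _ fun j _ => hm j) aestronglyMeasurable_id
    hψ.aestronglyMeasurable
  simpa [h0] using h_factor

lemma integral_sum_sq [IsProbabilityMeasure P] (hI : iIndepFun ξ P)
    (h2 : ∀ i, MemLp (ξ i) 2 P) (h0 : ∀ i, ∫ ω, ξ i ω ∂P = 0) (s : Finset ι) :
    ∫ ω, (∑ i ∈ s, ξ i ω) ^ 2 ∂P = ∑ i ∈ s, ∫ ω, ξ i ω ^ 2 ∂P := by
  have h_mean : ∫ ω, (∑ i ∈ s, ξ i) ω ∂P = 0 := by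
    simp only [Finset.sum_apply]
    rw [integral_finsetSum _ fun i _ => (h2 i).integrable (by norm_num)]
    exact Finset.sum_eq_zero fun i _ => h0 i
  have h_var := IndepFun.variance_sum (s := s) (fun i _ => h2 i)
    (fun i _ j _ hij => hI.indepFun hij)
  rw [variance_of_integral_eq_zero (memLp_finsetSum' s fun i _ => h2 i).aemeasurable h_mean]
    at h_var
  simp only [Finset.sum_apply] at h_var
  rw [h_var]
  exact Finset.sum_congr rfl fun i _ =>
    variance_of_integral_eq_zero (h2 i).aemeasurable (h0 i)

/-- The projection of `x` to the interval `[-L, L]`: a monotone test function with slope one near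
the origin, to which the leave-one-out identity is applied. -/
def clamp (L x : ℝ) : ℝ := max (-L) (min L x)

lemma measurable_clamp (L : ℝ) : Measurable (clamp L) := by unfold clamp; fun_prop

lemma abs_clamp_le {L : ℝ} (hL : 0 ≤ L) (x : ℝ) : |clamp L x| ≤ L :=
  abs_le.2 ⟨le_max_left _ _, max_le (by linarith) (min_le_left _ _)⟩

lemma monotone_clamp (L : ℝ) : Monotone (clamp L) := fun _ _ h =>
  max_le_max le_rfl (min_le_min le_rfl h)

lemma clamp_of_abs_le {L x : ℝ} (h : |x| ≤ L) : clamp L x = x := by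
  rw [clamp, min_eq_right (abs_le.1 h).2, max_eq_right (abs_le.1 h).1]

lemma mul_clamp_sub_nonneg (L x u : ℝ) : 0 ≤ u * (clamp L x - clamp L (x - u)) := by
  rcases le_total 0 u with h | h
  · exact mul_nonneg h (sub_nonneg.2 (monotone_clamp L (by linarith)))
  · exact mul_nonneg_of_nonpos_of_nonpos h (sub_nonpos.2 (monotone_clamp L (by linarith)))

/-- The square of `u`, with growth made linear beyond `|u| = γ`; its sums have small variance. -/
def truncSq (γ u : ℝ) : ℝ := |u| * min |u| γ

lemma measurable_truncSq (γ : ℝ) : Measurable (truncSq γ) := by unfold truncSq; fun_prop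

lemma abs_truncSq_le {γ : ℝ} (hγ : 0 ≤ γ) (u : ℝ) : |truncSq γ u| ≤ γ * |u| := by
  rw [truncSq, abs_mul, abs_abs, abs_of_nonneg (le_min (abs_nonneg u) hγ), mul_comm]
  exact mul_le_mul_of_nonneg_right (min_le_right _ _) (abs_nonneg u)

lemma sq_sub_le_truncSq {γ : ℝ} (hγ : 0 < γ) (u : ℝ) :
    u ^ 2 - 1 / (4 * γ) * |u| ^ 3 ≤ truncSq γ u := by
  have h_min : |u| - 1 / (4 * γ) * |u| ^ 2 ≤ min |u| γ := by
    refine le_min (sub_le_self _ (by positivity)) ?_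
    have h_square : γ - (|u| - 1 / (4 * γ) * |u| ^ 2) = (2 * γ - |u|) ^ 2 / (4 * γ) := by
      field_simp
      ring
    have : 0 ≤ (2 * γ - |u|) ^ 2 / (4 * γ) := by positivity
    linarith
  calc u ^ 2 - 1 / (4 * γ) * |u| ^ 3 = |u| * (|u| - 1 / (4 * γ) * |u| ^ 2) := by
        rw [← sq_abs]; ring
    _ ≤ truncSq γ u := mul_le_mul_of_nonneg_left h_min (abs_nonneg u)

lemma truncSq_le_mul_clamp_sub {r γ x : ℝ} (hγ : 0 ≤ γ) (hx : |x| ≤ r) (u : ℝ) :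
    truncSq γ u ≤ u * (clamp (r + γ) x - clamp (r + γ) (x - u)) := by
  have hx' := abs_le.1 hx
  rw [truncSq, clamp_of_abs_le (hx.trans (by linarith))]
  rcases le_total 0 u with h | h
  · have h_clamp : clamp (r + γ) (x - u) ≤ x - min u γ :=
      max_le (by linarith [min_le_right u γ])
        ((min_le_right _ _).trans (by linarith [min_le_left u γ]))
    rw [abs_of_nonneg h]
    exact mul_le_mul_of_nonneg_left (by linarith) h
  · have h_clamp : x + min (-u) γ ≤ clamp (r + γ) (x - u) :=
      le_max_of_le_right (le_min (by linarith [min_le_right (-u) γ])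
        (by linarith [min_le_left (-u) γ]))
    rw [abs_of_nonpos h]
    nlinarith

section Concentration

variable [IsProbabilityMeasure P] (h3 : ∀ i, MemLp (ξ i) 3 P) (s : Finset ι) {γ : ℝ}

include h3

lemma memLp_truncSq (hγ : 0 ≤ γ) (i : ι) : MemLp (fun ω => truncSq γ (ξ i ω)) 2 P :=
  ((memLp_two_of_memLp_three (h3 i)).abs.const_mul γ).mono
    ((measurable_truncSq γ).comp_aemeasurable (h3 i).aemeasurable).aestronglyMeasurable
    (.of_forall fun ω => by
      simpa [abs_mul, abs_of_nonneg hγ] using abs_truncSq_le hγ (ξ i ω))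

lemma quarter_le_integral_sum_truncSq (hv : 1 / 2 ≤ ∑ i ∈ s, ∫ ω, ξ i ω ^ 2 ∂P) (hγ0 : 0 < γ)
    (hγ : ∑ i ∈ s, ∫ ω, |ξ i ω| ^ 3 ∂P ≤ γ) :
    1 / 4 ≤ ∫ ω, ∑ i ∈ s, truncSq γ (ξ i ω) ∂P := by
  have h_int (i : ι) := (memLp_truncSq h3 hγ0.le i).integrable (by norm_num)
  have h_sq (i : ι) := (memLp_two_of_memLp_three (h3 i)).integrable_sq
  have h_cube (i : ι) := (integrable_abs_pow_three (h3 i)).const_mul (1 / (4 * γ))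
  calc (1 / 4 : ℝ) = 1 / 2 - 1 / (4 * γ) * γ := by field_simp; norm_num
    _ ≤ ∑ i ∈ s, ∫ ω, ξ i ω ^ 2 ∂P - 1 / (4 * γ) * ∑ i ∈ s, ∫ ω, |ξ i ω| ^ 3 ∂P := by gcongr
    _ = ∑ i ∈ s, ∫ ω, (ξ i ω ^ 2 - 1 / (4 * γ) * |ξ i ω| ^ 3) ∂P := by
        simp_rw [Finset.mul_sum, ← Finset.sum_sub_distrib, ← integral_const_mul]
        exact Finset.sum_congr rfl fun i _ => (integral_sub (h_sq i) (h_cube i)).symm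
    _ ≤ ∑ i ∈ s, ∫ ω, truncSq γ (ξ i ω) ∂P := Finset.sum_le_sum fun i _ =>
        integral_mono ((h_sq i).sub (h_cube i)) (h_int i) fun ω => sq_sub_le_truncSq hγ0 (ξ i ω)
    _ = ∫ ω, ∑ i ∈ s, truncSq γ (ξ i ω) ∂P := (integral_finsetSum _ fun i _ => h_int i).symm

lemma variance_sum_truncSq_le (hI : iIndepFun ξ P) (hv : ∑ i ∈ s, ∫ ω, ξ i ω ^ 2 ∂P ≤ 1)
    (hγ : 0 ≤ γ) : variance (fun ω => ∑ i ∈ s, truncSq γ (ξ i ω)) P ≤ γ ^ 2 := by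
  have h_memLp := memLp_truncSq h3 hγ
  have h_sum : variance (fun ω => ∑ i ∈ s, truncSq γ (ξ i ω)) P
      = ∑ i ∈ s, variance (fun ω => truncSq γ (ξ i ω)) P := by
    simpa only [Finset.sum_fn] using IndepFun.variance_sum (fun i _ => h_memLp i)
      fun i _ j _ hij => (hI.indepFun hij).comp (measurable_truncSq γ) (measurable_truncSq γ)
  have h_summand (i : ι) :
      variance (fun ω => truncSq γ (ξ i ω)) P ≤ γ ^ 2 * ∫ ω, ξ i ω ^ 2 ∂P := by
    refine (variance_le_expectation_sq (h_memLp i).aestronglyMeasurable).trans ?_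
    rw [← integral_const_mul]
    refine integral_mono (h_memLp i).integrable_sq
      ((memLp_two_of_memLp_three (h3 i)).integrable_sq.const_mul _) fun ω => ?_
    simpa only [Pi.pow_apply, sq_abs, mul_pow] using
      pow_le_pow_left₀ (abs_nonneg _) (abs_truncSq_le hγ (ξ i ω)) 2
  calc variance (fun ω => ∑ i ∈ s, truncSq γ (ξ i ω)) P
      ≤ ∑ i ∈ s, γ ^ 2 * ∫ ω, ξ i ω ^ 2 ∂P :=
        h_sum.trans_le (Finset.sum_le_sum fun i _ => h_summand i)
    _ = γ ^ 2 * ∑ i ∈ s, ∫ ω, ξ i ω ^ 2 ∂P := (Finset.mul_sum _ _ _).symm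
    _ ≤ γ ^ 2 := mul_le_of_le_one_right (sq_nonneg γ) hv

omit [IsProbabilityMeasure P] h3 in
lemma indicator_mul_sum_truncSq_le [DecidableEq ι] (x : ι → ℝ) (m : ℝ) {r : ℝ} (hr : 0 ≤ r)
    (hγ : 0 ≤ γ) :
    (if |∑ i ∈ s, x i - m| ≤ r then ∑ i ∈ s, truncSq γ (x i) else 0)
      ≤ (r + γ) * |∑ i ∈ s, x i|
        - ∑ i ∈ s, x i * clamp (r + γ) (∑ j ∈ s.erase i, x j - m) := by
  set v := ∑ i ∈ s, x i
  have h_leave_one_out : ∑ i ∈ s, x i * (clamp (r + γ) (v - m) - clamp (r + γ) (v - m - x i))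
      = v * clamp (r + γ) (v - m)
        - ∑ i ∈ s, x i * clamp (r + γ) (∑ j ∈ s.erase i, x j - m) := by
    simp only [mul_sub, Finset.sum_sub_distrib, ← Finset.sum_mul, v]
    congr 1
    refine Finset.sum_congr rfl fun i hi => ?_
    rw [Finset.sum_erase_eq_sub hi]
    ring_nf
  have h_clamp : v * clamp (r + γ) (v - m) ≤ (r + γ) * |v| := by
    rw [mul_comm (r + γ)]
    refine (le_abs_self _).trans ?_
    rw [abs_mul]
    exact mul_le_mul_of_nonneg_left (abs_clamp_le (by positivity) _) (abs_nonneg _)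
  refine le_trans ?_ (h_leave_one_out.le.trans (sub_le_sub_right h_clamp _))
  split_ifs with h
  · exact Finset.sum_le_sum fun i _ => truncSq_le_mul_clamp_sub hγ h (x i)
  · exact Finset.sum_nonneg fun i _ => mul_clamp_sub_nonneg _ _ (x i)

lemma integrable_mul_clamp_sum_erase [DecidableEq ι] {L : ℝ} (hL : 0 ≤ L) (m : ℝ) (i : ι) :
    Integrable (fun ω => ξ i ω * clamp L (∑ j ∈ s.erase i, ξ j ω - m)) P :=
  ((h3 i).integrable (by norm_num)).mul_bdd
    ((measurable_clamp L).comp_aemeasurable ((Finset.aemeasurable_fun_sum _ fun j _ =>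
      (h3 j).aemeasurable).sub_const m)).aestronglyMeasurable
    (.of_forall fun _ => abs_clamp_le hL _)

lemma integral_mul_abs_sum_sub_sum_clamp_le [DecidableEq ι] (hI : iIndepFun ξ P)
    (h0 : ∀ i, ∫ ω, ξ i ω ∂P = 0) (hv : ∑ i ∈ s, ∫ ω, ξ i ω ^ 2 ∂P ≤ 1) {L : ℝ} (hL : 0 ≤ L)
    (m : ℝ) :
    ∫ ω, (L * |∑ i ∈ s, ξ i ω|
      - ∑ i ∈ s, ξ i ω * clamp L (∑ j ∈ s.erase i, ξ j ω - m)) ∂P ≤ L := by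
  have h2 (i : ι) : MemLp (ξ i) 2 P := memLp_two_of_memLp_three (h3 i)
  have h_sum : MemLp (fun ω => ∑ i ∈ s, ξ i ω) 2 P := memLp_finsetSum s fun i _ => h2 i
  have h_clamp_int : ∀ i ∈ s,
      Integrable (fun ω => ξ i ω * clamp L (∑ j ∈ s.erase i, ξ j ω - m)) P :=
    fun i _ => integrable_mul_clamp_sum_erase h3 s hL m i
  have h_clamp_zero :
      ∫ ω, ∑ i ∈ s, ξ i ω * clamp L (∑ j ∈ s.erase i, ξ j ω - m) ∂P = 0 := by
    rw [integral_finsetSum s h_clamp_int]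
    exact Finset.sum_eq_zero fun i _ => integral_mul_comp_sum_erase_eq_zero hI
      (fun j => (h3 j).aemeasurable) s (h0 i)
      (ψ := fun x => clamp L (x - m)) ((measurable_clamp L).comp (measurable_id.sub_const m))
  have h_sum_le : ∫ ω, |∑ i ∈ s, ξ i ω| ∂P ≤ 1 :=
    integral_abs_le_of_integral_sq_le h_sum zero_le_one
      (by rwa [integral_sum_sq hI h2 h0, one_pow])
  rw [integral_sub ((h_sum.integrable (by norm_num)).abs.const_mul L)
    (integrable_finsetSum s h_clamp_int), h_clamp_zero, sub_zero, integral_const_mul]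
  exact mul_le_of_le_one_right hL h_sum_le

omit h3 in
lemma measureReal_mul_integral_le {A : Set Ω} (hA : NullMeasurableSet A P) {Y Z : Ω → ℝ}
    (hY : Integrable Y P) (hZ : Integrable Z P) (h : ∀ ω, A.indicator Y ω ≤ Z ω) :
    P.real A * ∫ ω, Y ω ∂P ≤ ∫ ω, Z ω ∂P + ∫ ω, |Y ω - ∫ ω', Y ω' ∂P| ∂P := by
  set e := ∫ ω, Y ω ∂P
  have h_dev : Integrable (fun ω => |Y ω - e|) P := (hY.sub (integrable_const e)).abs
  have h_pointwise (ω : Ω) : A.indicator (fun _ => e) ω ≤ Z ω + |Y ω - e| := by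
    have h_le := h ω
    by_cases hω : ω ∈ A
    · rw [indicator_of_mem hω] at h_le ⊢
      linarith [neg_abs_le (Y ω - e)]
    · rw [indicator_of_notMem hω] at h_le ⊢
      positivity
  calc P.real A * e = ∫ ω, A.indicator (fun _ => e) ω ∂P := by
        rw [integral_indicator₀ hA, setIntegral_const, smul_eq_mul]
    _ ≤ ∫ ω, (Z ω + |Y ω - e|) ∂P :=
        integral_mono ((integrable_const e).indicator₀ hA) (hZ.add h_dev) h_pointwise
    _ = ∫ ω, Z ω ∂P + ∫ ω, |Y ω - e| ∂P := integral_add hZ h_dev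

theorem measureReal_abs_sum_sub_le (hI : iIndepFun ξ P) (h0 : ∀ i, ∫ ω, ξ i ω ∂P = 0)
    (hv : 1 / 2 ≤ ∑ i ∈ s, ∫ ω, ξ i ω ^ 2 ∂P) (hv1 : ∑ i ∈ s, ∫ ω, ξ i ω ^ 2 ∂P ≤ 1)
    (hγ0 : 0 < γ) (hγ : ∑ i ∈ s, ∫ ω, |ξ i ω| ^ 3 ∂P ≤ γ) (m : ℝ) {r : ℝ} (hr : 0 ≤ r) :
    P.real {ω | |∑ i ∈ s, ξ i ω - m| ≤ r} ≤ 4 * r + 8 * γ := by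
  classical
  have hL : 0 ≤ r + γ := by positivity
  have h_sum : MemLp (fun ω => ∑ i ∈ s, ξ i ω) 2 P :=
    memLp_finsetSum s fun i _ => memLp_two_of_memLp_three (h3 i)
  have h_trunc : MemLp (fun ω => ∑ i ∈ s, truncSq γ (ξ i ω)) 2 P :=
    memLp_finsetSum s fun i _ => memLp_truncSq h3 hγ0.le i
  have h_dev : ∫ ω, |∑ i ∈ s, truncSq γ (ξ i ω) - ∫ ω', ∑ i ∈ s, truncSq γ (ξ i ω') ∂P| ∂P ≤ γ :=
    integral_abs_le_of_integral_sq_le (h_trunc.sub (memLp_const _)) hγ0.le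
      ((variance_eq_integral h_trunc.aemeasurable).symm.trans_le
        (variance_sum_truncSq_le h3 s hI hv1 hγ0.le))
  have h_le := measureReal_mul_integral_le (A := {ω | |∑ i ∈ s, ξ i ω - m| ≤ r})
    (nullMeasurableSet_le (h_sum.aemeasurable.sub_const m).abs aemeasurable_const)
    (h_trunc.integrable (by norm_num))
    (((h_sum.integrable (by norm_num)).abs.const_mul (r + γ)).sub
      (integrable_finsetSum s fun i _ => integrable_mul_clamp_sum_erase h3 s hL m i))
    fun ω => indicator_mul_sum_truncSq_le s (fun i => ξ i ω) m hr hγ0.le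
  have h_clamp := integral_mul_abs_sum_sub_sum_clamp_le h3 s hI h0 hv1 hL m
  have h_quarter := mul_le_mul_of_nonneg_left (quarter_le_integral_sum_truncSq h3 s hv hγ0 hγ)
    (measureReal_nonneg (μ := P) (s := {ω | |∑ i ∈ s, ξ i ω - m| ≤ r}))
  simp only [Pi.sub_apply] at h_le
  linarith

end Concentration

end IndependentSums

/-! ### The Berry–Esseen bound -/

section LeaveOneOut

variable {Ω : Type*} [MeasurableSpace Ω] {P : Measure Ω} [IsProbabilityMeasure P] {X U : Ω → ℝ}

lemma measurable_ite_abs_sub_le (z : ℝ) :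
    Measurable fun p : ℝ × ℝ => if |p.2 - z| ≤ |p.1| then (1 : ℝ) else 0 :=
  .ite (measurableSet_le (by fun_prop) (by fun_prop)) measurable_const measurable_const

lemma measurable_steinBound (z v : ℝ) : Measurable (Function.uncurry (steinBound z v)) := by
  have := measurable_ite_abs_sub_le z
  simp only [Function.uncurry_def, steinBound]
  fun_prop

lemma add_sq_mul_abs (v x : ℝ) : (v + x ^ 2) * |x| = v * |x| + |x| ^ 3 := by
  rw [← sq_abs x]
  ring

lemma integrable_add_sq_mul_abs (hX : MemLp X 3 P) (v : ℝ) :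
    Integrable (fun ω => (v + X ω ^ 2) * |X ω|) P := by
  simp only [add_sq_mul_abs]
  exact ((hX.integrable (by norm_num)).abs.const_mul v).add (integrable_abs_pow_three hX)

lemma integral_add_sq_mul_abs_le (hX : MemLp X 3 P) :
    ∫ ω, ((∫ ω', X ω' ^ 2 ∂P) + X ω ^ 2) * |X ω| ∂P ≤ 2 * ∫ ω, |X ω| ^ 3 ∂P := by
  set v := ∫ ω', X ω' ^ 2 ∂P
  simp only [add_sq_mul_abs]
  rw [integral_add ((hX.integrable (by norm_num)).abs.const_mul v) (integrable_abs_pow_three hX),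
    integral_const_mul]
  linarith [integral_sq_mul_integral_abs_le hX]

lemma integrable_steinBound (hXU : IndepFun X U P) (hX : MemLp X 3 P) (hU : Integrable U P)
    (z v : ℝ) : Integrable (fun ω => steinBound z v (X ω) (U ω)) P := by
  have h_smooth : Integrable (fun ω => ((v + X ω ^ 2) * |X ω|) * (5 + 2 * |U ω|)) P :=
    (hXU.comp (φ := fun x => (v + x ^ 2) * |x|) (ψ := fun u => 5 + 2 * |u|) (by fun_prop)
      (by fun_prop)).integrable_mul (integrable_add_sq_mul_abs hX v)
      ((integrable_const 5).add (hU.abs.const_mul 2))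
  have h_sq : Integrable (fun ω => v + X ω ^ 2) P :=
    (integrable_const v).add (memLp_two_of_memLp_three hX).integrable_sq
  have h_ite : AEMeasurable (fun ω => if |U ω - z| ≤ |X ω| then (1 : ℝ) else 0) P :=
    (measurable_ite_abs_sub_le z).comp_aemeasurable (hX.aemeasurable.prodMk hU.aemeasurable)
  have h_jump : Integrable (fun ω => (v + X ω ^ 2) * if |U ω - z| ≤ |X ω| then (1 : ℝ) else 0) P :=
    h_sq.mul_bdd (c := 1) h_ite.aestronglyMeasurable (.of_forall fun ω => by split_ifs <;> simp)
  refine (h_smooth.add (h_jump.const_mul 4)).congr (.of_forall fun ω => ?_)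
  simp only [steinBound, Pi.add_apply]
  ring

lemma integral_steinBound_le (hU : Integrable U P) (hU1 : ∫ ω, |U ω| ∂P ≤ 1) {z γ : ℝ}
    (h_conc : ∀ r, 0 ≤ r → P.real {ω | |U ω - z| ≤ r} ≤ 4 * r + 8 * γ) {v : ℝ} (hv : 0 ≤ v)
    (x : ℝ) : ∫ ω, steinBound z v x (U ω) ∂P ≤ (v + x ^ 2) * (23 * |x| + 32 * γ) := by
  have h_set : NullMeasurableSet {ω | |U ω - z| ≤ |x|} P :=
    nullMeasurableSet_le (hU.aemeasurable.sub_const z).abs aemeasurable_const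
  have h_ite (ω : Ω) : (if |U ω - z| ≤ |x| then (1 : ℝ) else 0)
      = {ω | |U ω - z| ≤ |x|}.indicator (fun _ => 1) ω := by simp [indicator]
  have h_ind : Integrable ({ω | |U ω - z| ≤ |x|}.indicator fun _ => (1 : ℝ)) P :=
    (integrable_const 1).indicator₀ h_set
  have h_lin : Integrable (fun ω => |x| * (5 + 2 * |U ω|)) P :=
    ((integrable_const 5).add (hU.abs.const_mul 2)).const_mul _
  have h_eq : ∫ ω, steinBound z v x (U ω) ∂P = (v + x ^ 2)
      * (|x| * (5 + 2 * ∫ ω, |U ω| ∂P) + 4 * P.real {ω | |U ω - z| ≤ |x|}) := by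
    simp only [steinBound, h_ite]
    rw [integral_const_mul, integral_add h_lin (h_ind.const_mul 4), integral_const_mul,
      integral_const_mul, integral_add (integrable_const 5) (hU.abs.const_mul 2),
      integral_const_mul, integral_indicator₀ h_set]
    simp
  rw [h_eq]
  refine mul_le_mul_of_nonneg_left ?_ (by positivity)
  nlinarith [abs_nonneg x, h_conc |x| (abs_nonneg x)]

lemma integral_stein_eq_integral_remainder (hXU : IndepFun X U P) (hX : MemLp X 3 P)
    (hX0 : ∫ ω, X ω ∂P = 0) (hU : AEMeasurable U P) (z : ℝ) :
    ∫ ω, ((∫ ω', X ω' ^ 2 ∂P) * steinDeriv z (U ω + X ω) - X ω * steinSol z (U ω + X ω)) ∂P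
      = ∫ ω, ((∫ ω', X ω' ^ 2 ∂P) * (steinDeriv z (U ω + X ω) - steinDeriv z (U ω))
        - X ω * (steinSol z (U ω + X ω) - steinSol z (U ω) - X ω * steinDeriv z (U ω))) ∂P := by
  set v := ∫ ω', X ω' ^ 2 ∂P
  have h_sol := (continuous_steinSol z).measurable
  have h_deriv := measurable_steinDeriv z
  have h_deriv_int {V : Ω → ℝ} (hV : AEMeasurable V P) :
      Integrable (fun ω => v * steinDeriv z (V ω)) P :=
    (Integrable.of_bound (h_deriv.comp_aemeasurable hV).aestronglyMeasurable 2
      (.of_forall fun ω => abs_steinDeriv_le z _)).const_mul _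
  have h_sol_int {V : Ω → ℝ} (hV : AEMeasurable V P) :
      Integrable (fun ω => X ω * steinSol z (V ω)) P :=
    (hX.integrable (by norm_num)).mul_bdd (h_sol.comp_aemeasurable hV).aestronglyMeasurable
      (.of_forall fun ω => abs_steinSol_le z _)
  have h_sq_int : Integrable (fun ω => X ω ^ 2 * steinDeriv z (U ω)) P :=
    (memLp_two_of_memLp_three hX).integrable_sq.mul_bdd
      (h_deriv.comp_aemeasurable hU).aestronglyMeasurable
      (.of_forall fun ω => abs_steinDeriv_le z _)
  have h_sol_zero : ∫ ω, X ω * steinSol z (U ω) ∂P = 0 := by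
    simpa [hX0] using hXU.integral_fun_comp_mul_comp hX.aemeasurable hU
      aestronglyMeasurable_id h_sol.aestronglyMeasurable
  have h_sq_eq : ∫ ω, X ω ^ 2 * steinDeriv z (U ω) ∂P = ∫ ω, v * steinDeriv z (U ω) ∂P := by
    rw [integral_const_mul]
    exact hXU.integral_fun_comp_mul_comp (f := fun x => x ^ 2) hX.aemeasurable hU
      (by fun_prop) h_deriv.aestronglyMeasurable
  have h_main : Integrable (fun ω => v * steinDeriv z (U ω + X ω)
      - X ω * steinSol z (U ω + X ω)) P :=
    (h_deriv_int (hU.add hX.aemeasurable)).sub (h_sol_int (hU.add hX.aemeasurable))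
  have h_diff : Integrable (fun ω => X ω ^ 2 * steinDeriv z (U ω) - v * steinDeriv z (U ω)) P :=
    h_sq_int.sub (h_deriv_int hU)
  have h_corr : ∫ ω, (X ω * steinSol z (U ω)
      + (X ω ^ 2 * steinDeriv z (U ω) - v * steinDeriv z (U ω))) ∂P = 0 := by
    rw [integral_add (h_sol_int hU) h_diff, integral_sub h_sq_int (h_deriv_int hU), h_sol_zero,
      h_sq_eq, sub_self, add_zero]
  rw [← add_zero (∫ ω, _ ∂P), ← h_corr]
  refine (integral_add h_main ((h_sol_int hU).add h_diff)).symm.trans (integral_congr_ae ?_)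
  exact .of_forall fun ω => by simp only [Pi.add_apply]; ring

lemma abs_integral_stein_le (hXU : IndepFun X U P) (hX : MemLp X 3 P) (hX0 : ∫ ω, X ω ∂P = 0)
    (hU : Integrable U P) (hU1 : ∫ ω, |U ω| ∂P ≤ 1) {z γ : ℝ}
    (h_conc : ∀ r, 0 ≤ r → P.real {ω | |U ω - z| ≤ r} ≤ 4 * r + 8 * γ) :
    |∫ ω, ((∫ ω', X ω' ^ 2 ∂P) * steinDeriv z (U ω + X ω) - X ω * steinSol z (U ω + X ω)) ∂P|
      ≤ 46 * (∫ ω, |X ω| ^ 3 ∂P) + 64 * γ * ∫ ω, X ω ^ 2 ∂P := by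
  rw [integral_stein_eq_integral_remainder hXU hX hX0 hU.aemeasurable z]
  have h_cube_le := integral_add_sq_mul_abs_le hX
  set v := ∫ ω', X ω' ^ 2 ∂P with hv
  have hv0 : 0 ≤ v := integral_nonneg fun ω => sq_nonneg _
  have h_sq : Integrable (fun ω => X ω ^ 2) P := (memLp_two_of_memLp_three hX).integrable_sq
  have h_cube := (integrable_add_sq_mul_abs hX v).const_mul 23
  have h_const : Integrable (fun ω => 32 * γ * (v + X ω ^ 2)) P :=
    ((integrable_const v).add h_sq).const_mul _
  have h_expand (x : ℝ) :
      (v + x ^ 2) * (23 * |x| + 32 * γ) = 23 * ((v + x ^ 2) * |x|) + 32 * γ * (v + x ^ 2) := by ring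
  have h_int := integrable_steinBound hXU hX hU z v
  calc _ ≤ ∫ ω, steinBound z v (X ω) (U ω) ∂P :=
        abs_integral_le_integral_abs.trans <| integral_mono_of_nonneg
          (.of_forall fun ω => abs_nonneg _) h_int
          (.of_forall fun ω => abs_stein_remainder_le z (U ω) (X ω) hv0)
    _ ≤ ∫ ω, (v + X ω ^ 2) * (23 * |X ω| + 32 * γ) ∂P :=
        integral_comp_le_of_indepFun hXU hX.aemeasurable hU.aemeasurable
          (measurable_steinBound z v) h_int (H := fun x => (v + x ^ 2) * (23 * |x| + 32 * γ))
          (by fun_prop) (by simp only [h_expand]; exact h_cube.add h_const)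
          fun x => integral_steinBound_le hU hU1 h_conc hv0 x
    _ = 23 * ∫ ω, (v + X ω ^ 2) * |X ω| ∂P + 32 * γ * (v + v) := by
        simp only [h_expand]
        rw [integral_add h_cube h_const, integral_const_mul, integral_const_mul,
          integral_add (integrable_const v) h_sq, integral_const, probReal_univ, one_smul, hv]
    _ ≤ 46 * (∫ ω, |X ω| ^ 3 ∂P) + 64 * γ * v := by linarith

end LeaveOneOut

section BerryEsseen

variable {Ω : Type*} [MeasurableSpace Ω] {P : Measure Ω} [IsProbabilityMeasure P] {ι : Type*}
  {ξ : ι → Ω → ℝ}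

lemma abs_measureReal_sub_stdCDF_le_one (A : Set Ω) (x : ℝ) : |P.real A - stdCDF x| ≤ 1 :=
  abs_sub_le_of_nonneg_of_le measureReal_nonneg measureReal_le_one (stdCDF_nonneg x)
    (stdCDF_le_one x)

variable (hI : iIndepFun ξ P) (h3 : ∀ i, MemLp (ξ i) 3 P) (h0 : ∀ i, ∫ ω, ξ i ω ∂P = 0)
  {s : Finset ι} (hv : ∑ i ∈ s, ∫ ω, ξ i ω ^ 2 ∂P = 1)

include h3 hv in
lemma measureReal_sub_stdCDF_eq_sum (z : ℝ) :
    P.real {ω | ∑ i ∈ s, ξ i ω ≤ z} - stdCDF z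
      = ∑ i ∈ s, ∫ ω, ((∫ ω', ξ i ω' ^ 2 ∂P) * steinDeriv z (∑ j ∈ s, ξ j ω)
        - ξ i ω * steinSol z (∑ j ∈ s, ξ j ω)) ∂P := by
  set W : Ω → ℝ := fun ω => ∑ i ∈ s, ξ i ω
  have hW : AEMeasurable W P := Finset.aemeasurable_fun_sum _ fun j _ => (h3 j).aemeasurable
  have h_set : NullMeasurableSet {ω | W ω ≤ z} P := nullMeasurableSet_le hW aemeasurable_const
  have h_deriv_int : Integrable (fun ω => steinDeriv z (W ω)) P :=
    .of_bound ((measurable_steinDeriv z).comp_aemeasurable hW).aestronglyMeasurable 2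
      (.of_forall fun ω => abs_steinDeriv_le z _)
  have h_sol_int (i : ι) : Integrable (fun ω => ξ i ω * steinSol z (W ω)) P :=
    ((h3 i).integrable (by norm_num)).mul_bdd
      ((continuous_steinSol z).measurable.comp_aemeasurable hW).aestronglyMeasurable
      (.of_forall fun ω => abs_steinSol_le z _)
  have h_stein (ω : Ω) : {ω | W ω ≤ z}.indicator (fun _ => (1 : ℝ)) ω - stdCDF z
      = ∑ i ∈ s, ((∫ ω', ξ i ω' ^ 2 ∂P) * steinDeriv z (W ω) - ξ i ω * steinSol z (W ω)) := by
    rw [Finset.sum_sub_distrib, ← Finset.sum_mul, ← Finset.sum_mul, hv]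
    simp only [steinDeriv, indicator, mem_ofPred_eq]
    ring
  calc P.real {ω | W ω ≤ z} - stdCDF z
      = ∫ ω, ({ω | W ω ≤ z}.indicator (fun _ => (1 : ℝ)) ω - stdCDF z) ∂P := by
        rw [integral_sub ((integrable_const 1).indicator₀ h_set) (integrable_const _),
          integral_indicator₀ h_set]
        simp
    _ = _ := by
        simp only [h_stein]
        exact integral_finsetSum s fun i _ => (h_deriv_int.const_mul _).sub (h_sol_int i)

include hI h3 h0 hv

lemma abs_integral_stein_summand_le {γ : ℝ} (hγ0 : 0 < γ)
    (hγ : ∑ i ∈ s, ∫ ω, |ξ i ω| ^ 3 ∂P ≤ γ) (hγ8 : γ ≤ 1 / 8) (z : ℝ) {i : ι} (hi : i ∈ s) :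
    |∫ ω, ((∫ ω', ξ i ω' ^ 2 ∂P) * steinDeriv z (∑ j ∈ s, ξ j ω)
        - ξ i ω * steinSol z (∑ j ∈ s, ξ j ω)) ∂P|
      ≤ 46 * (∫ ω, |ξ i ω| ^ 3 ∂P) + 64 * γ * ∫ ω, ξ i ω ^ 2 ∂P := by
  classical
  have h2 (j : ι) : MemLp (ξ j) 2 P := memLp_two_of_memLp_three (h3 j)
  have h_cube_nonneg (j : ι) : 0 ≤ ∫ ω, |ξ j ω| ^ 3 ∂P := integral_nonneg fun ω => by positivity
  have h_var : ∫ ω, ξ i ω ^ 2 ∂P + ∑ j ∈ s.erase i, ∫ ω, ξ j ω ^ 2 ∂P = 1 :=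
    (Finset.add_sum_erase s (fun j => ∫ ω, ξ j ω ^ 2 ∂P) hi).trans hv
  have h_var_nonneg : 0 ≤ ∫ ω, ξ i ω ^ 2 ∂P := integral_nonneg fun ω => sq_nonneg _
  have h_var_le : ∫ ω, ξ i ω ^ 2 ∂P ≤ 1 / 2 := by
    have := Finset.single_le_sum (fun j _ => h_cube_nonneg j) hi
    linarith [integral_sq_le_quarter_add (h3 i)]
  have h_cube_le : ∑ j ∈ s.erase i, ∫ ω, |ξ j ω| ^ 3 ∂P ≤ γ :=
    (Finset.sum_le_sum_of_subset_of_nonneg (s.erase_subset i) fun j _ _ => h_cube_nonneg j).trans hγ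
  have hU : MemLp (fun ω => ∑ j ∈ s.erase i, ξ j ω) 2 P := memLp_finsetSum _ fun j _ => h2 j
  simp only [← Finset.sum_erase_add s _ hi]
  refine abs_integral_stein_le (indepFun_sum_erase hI (fun j => (h3 j).aemeasurable) s i) (h3 i)
    (h0 i) (hU.integrable (by norm_num)) ?_ fun r hr => ?_
  · refine integral_abs_le_of_integral_sq_le hU zero_le_one ?_
    rw [integral_sum_sq hI h2 h0]
    linarith
  · exact measureReal_abs_sum_sub_le h3 (s.erase i) hI h0 (by linarith) (by linarith) hγ0 h_cube_le
      z hr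

theorem berry_esseen_of_sum_variance_eq_one (z : ℝ) :
    |P.real {ω | ∑ i ∈ s, ξ i ω ≤ z} - stdCDF z| ≤ 110 * ∑ i ∈ s, ∫ ω, |ξ i ω| ^ 3 ∂P := by
  refine le_of_forall_pos_le_add fun δ hδ => ?_
  set γ := ∑ i ∈ s, ∫ ω, |ξ i ω| ^ 3 ∂P + δ / 110 with hγ_def
  have : 0 ≤ ∑ i ∈ s, ∫ ω, |ξ i ω| ^ 3 ∂P :=
    Finset.sum_nonneg fun i _ => integral_nonneg fun ω => by positivity
  have hγ0 : 0 < γ := by positivity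
  have hγ : ∑ i ∈ s, ∫ ω, |ξ i ω| ^ 3 ∂P ≤ γ := le_add_of_nonneg_right (by positivity)
  suffices |P.real {ω | ∑ i ∈ s, ξ i ω ≤ z} - stdCDF z| ≤ 110 * γ by linarith
  rcases lt_or_ge (1 / 8) γ with hγ8 | hγ8
  · linarith [abs_measureReal_sub_stdCDF_le_one (P := P) {ω | ∑ i ∈ s, ξ i ω ≤ z} z]
  rw [measureReal_sub_stdCDF_eq_sum h3 hv z]
  calc _ ≤ ∑ i ∈ s, |∫ ω, ((∫ ω', ξ i ω' ^ 2 ∂P) * steinDeriv z (∑ j ∈ s, ξ j ω)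
        - ξ i ω * steinSol z (∑ j ∈ s, ξ j ω)) ∂P| := Finset.abs_sum_le_sum_abs _ _
    _ ≤ ∑ i ∈ s, (46 * (∫ ω, |ξ i ω| ^ 3 ∂P) + 64 * γ * ∫ ω, ξ i ω ^ 2 ∂P) :=
        Finset.sum_le_sum fun i hi => abs_integral_stein_summand_le hI h3 h0 hv hγ0 hγ hγ8 z hi
    _ = 46 * (∑ i ∈ s, ∫ ω, |ξ i ω| ^ 3 ∂P) + 64 * γ := by
        rw [Finset.sum_add_distrib, ← Finset.mul_sum, ← Finset.mul_sum, hv, mul_one]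
    _ ≤ 110 * γ := by linarith

end BerryEsseen

/-! ### Infinite weighted sums of innovations -/

lemma summable_sq_of_summable {ι : Type*} {b : ι → ℝ} (hb : Summable b) :
    Summable fun i => b i ^ 2 := by
  refine .of_norm_bounded_eventually hb.abs ?_
  filter_upwards [hb.abs.tendsto_cofinite_zero.eventually_le_const one_pos] with i hi
  rw [Real.norm_eq_abs, abs_pow]
  exact pow_le_of_le_one (abs_nonneg _) hi two_ne_zero

section Limit

variable {Ω : Type*} [MeasurableSpace Ω] {P : Measure Ω} [IsFiniteMeasure P]

lemma measureReal_le_add_measureReal_le_dist (X Y : Ω → ℝ) (x η : ℝ) :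
    P.real {ω | X ω ≤ x} ≤ P.real {ω | Y ω ≤ x + η} + P.real {ω | η ≤ dist (X ω) (Y ω)} := by
  have h_sub : {ω | X ω ≤ x} ⊆ {ω | Y ω ≤ x + η} ∪ {ω | η ≤ dist (X ω) (Y ω)} := by
    intro ω (hω : X ω ≤ x)
    by_contra! h
    simp only [mem_union, mem_ofPred_eq, not_or, not_le, Real.dist_eq] at h
    linarith [abs_lt.1 h.2]
  exact (measureReal_mono h_sub).trans (measureReal_union_le _ _)

lemma abs_measureReal_sub_le_of_tendsto_ae {T : ℕ → Ω → ℝ} {S : Ω → ℝ}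
    (hT : ∀ J, AEStronglyMeasurable (T J) P)
    (hTS : ∀ᵐ ω ∂P, Tendsto (fun J => T J ω) atTop (𝓝 (S ω))) {F : ℝ → ℝ} (hF : Continuous F)
    {C : ℝ} (hC : ∀ y, ∀ δ > 0, ∀ᶠ J in atTop, |P.real {ω | T J ω ≤ y} - F y| ≤ C + δ) (x : ℝ) :
    |P.real {ω | S ω ≤ x} - F x| ≤ C := by
  refine le_of_forall_pos_le_add fun δ hδ => ?_
  obtain ⟨r, hr, hFr⟩ := Metric.continuousAt_iff.1 hF.continuousAt (δ / 3) (by positivity)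
  have h_close (y : ℝ) (hy : |y - x| = r / 2) : |F y - F x| < δ / 3 :=
    hFr (by rw [Real.dist_eq]; linarith)
  have h_right := abs_lt.1 (h_close (x + r / 2) (by simp [(half_pos hr).le]))
  have h_left := abs_lt.1 (h_close (x - r / 2) (by simp [(half_pos hr).le]))
  have h_dist := tendstoInMeasure_iff_measureReal_dist.1
    (tendstoInMeasure_of_tendsto_ae hT hTS) (r / 2) (half_pos hr)
  obtain ⟨J, hJ_dist, hJ_right, hJ_left⟩ :=
    ((h_dist.eventually_lt_const (show (0 : ℝ) < δ / 3 by positivity)).and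
      ((hC (x + r / 2) (δ / 3) (by positivity)).and
        (hC (x - r / 2) (δ / 3) (by positivity)))).exists
  have h_upper := measureReal_le_add_measureReal_le_dist (P := P) S (T J) x (r / 2)
  have h_lower := measureReal_le_add_measureReal_le_dist (P := P) (T J) S (x - r / 2) (r / 2)
  simp only [dist_comm (S _), sub_add_cancel] at h_upper h_lower
  rw [abs_le] at hJ_right hJ_left ⊢
  constructor <;> linarith

end Limit

section WeightedSums

variable {Ω : Type*} [MeasurableSpace Ω] {P : Measure Ω} {ε : ℤ → Ω → ℝ} {b : ℤ → ℝ}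

namespace IsInnovationSequence

lemma memLp_three (h : IsInnovationSequence P ε) (i : ℤ) : MemLp (ε i) 3 P :=
  (h.identDistrib i).symm.memLp_snd (memLp_three_of_integrable
    (h.identDistrib 0).aemeasurable_fst.aestronglyMeasurable h.third_moment)

lemma integral_eq_zero (h : IsInnovationSequence P ε) (i : ℤ) : ∫ ω, ε i ω ∂P = 0 :=
  (h.identDistrib i).integral_eq.trans h.mean_eq_zero

lemma integral_sq (h : IsInnovationSequence P ε) (i : ℤ) : ∫ ω, ε i ω ^ 2 ∂P = 1 :=
  ((h.identDistrib i).comp (u := fun x : ℝ => x ^ 2) (by fun_prop)).integral_eq.trans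
    h.second_moment

lemma integral_abs_pow_three (h : IsInnovationSequence P ε) (i : ℤ) :
    ∫ ω, |ε i ω| ^ 3 ∂P = ∫ ω, |ε 0 ω| ^ 3 ∂P :=
  ((h.identDistrib i).comp (u := fun x : ℝ => |x| ^ 3) (by fun_prop)).integral_eq

lemma ae_summable_mul (h : IsInnovationSequence P ε) (hb : Summable fun i => |b i|) :
    ∀ᵐ ω ∂P, Summable fun i => |b i * ε i ω| := by
  have := h.indep.isProbabilityMeasure
  have h_memLp (i : ℤ) : MemLp (ε i) 1 P := (h.memLp_three i).mono_exponent (by norm_num)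
  refine summable_norm_of_tsum_eLpNorm_ne_top (p := 1) le_rfl (f := fun i ω => b i * ε i ω)
    (fun i => ((h_memLp i).const_mul (b i)).aestronglyMeasurable) ?_
  have h_norm (i : ℤ) : eLpNorm (fun ω => b i * ε i ω) 1 P = ‖b i‖ₑ * eLpNorm (ε 0) 1 P := by
    rw [← (h.identDistrib i).eLpNorm_eq]
    exact eLpNorm_const_smul (b i) (ε i) 1 P
  simp only [h_norm, ENNReal.tsum_mul_right]
  exact ENNReal.mul_ne_top (tsum_enorm_ne_top_iff_summable_norm.2 hb) (h_memLp 0).eLpNorm_ne_top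

lemma sum_integral_abs_pow_three_le (h : IsInnovationSequence P ε) {A : ℝ}
    (hA : ∀ i, |b i| ≤ A) {s : Finset ℤ} (hs : 0 < ∑ i ∈ s, b i ^ 2) :
    ∑ i ∈ s, ∫ ω, |b i / √(∑ i ∈ s, b i ^ 2) * ε i ω| ^ 3 ∂P
      ≤ (∫ ω, |ε 0 ω| ^ 3 ∂P) * A / √(∑ i ∈ s, b i ^ 2) := by
  set v := ∑ i ∈ s, b i ^ 2 with hv
  set β := ∫ ω, |ε 0 ω| ^ 3 ∂P with hβ
  have : 0 ≤ β := integral_nonneg fun ω => by positivity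
  have h_sqrt : 0 < √v := Real.sqrt_pos.2 hs
  have h_cube : ∑ i ∈ s, |b i| ^ 3 ≤ A * v := by
    rw [hv, Finset.mul_sum]
    refine Finset.sum_le_sum fun i _ => ?_
    rw [pow_succ', sq_abs]
    exact mul_le_mul_of_nonneg_right (hA i) (sq_nonneg _)
  calc ∑ i ∈ s, ∫ ω, |b i / √v * ε i ω| ^ 3 ∂P = (∑ i ∈ s, |b i| ^ 3) / √v ^ 3 * β := by
        simp only [abs_mul, mul_pow, integral_const_mul, h.integral_abs_pow_three, ← hβ, abs_div,
          abs_of_pos h_sqrt, div_pow]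
        rw [← Finset.sum_mul, ← Finset.sum_div]
    _ ≤ A * v / √v ^ 3 * β := by gcongr
    _ = A * √v ^ 2 / √v ^ 3 * β := by rw [Real.sq_sqrt hs.le]
    _ = β * A / √v := by field_simp

lemma abs_measureReal_sum_sub_stdCDF_le (h : IsInnovationSequence P ε) {A : ℝ}
    (hA : ∀ i, |b i| ≤ A) {s : Finset ℤ} (hs : 0 < ∑ i ∈ s, b i ^ 2) (x : ℝ) :
    |P.real {ω | ∑ i ∈ s, b i * ε i ω ≤ x} - stdCDF (x / √(∑ i ∈ s, b i ^ 2))|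
      ≤ 110 * (∫ ω, |ε 0 ω| ^ 3 ∂P) * A / √(∑ i ∈ s, b i ^ 2) := by
  have := h.indep.isProbabilityMeasure
  set v := ∑ i ∈ s, b i ^ 2 with hv
  have h_sqrt : 0 < √v := Real.sqrt_pos.2 hs
  have h_var : ∑ i ∈ s, ∫ ω, (b i / √v * ε i ω) ^ 2 ∂P = 1 := by
    simp only [mul_pow, integral_const_mul, h.integral_sq, mul_one, div_pow, Real.sq_sqrt hs.le]
    rw [← Finset.sum_div, ← hv, div_self hs.ne']
  have h_scale (ω : Ω) : ∑ i ∈ s, b i / √v * ε i ω = (∑ i ∈ s, b i * ε i ω) / √v := by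
    rw [Finset.sum_div]
    exact Finset.sum_congr rfl fun i _ => by ring
  have h_be := berry_esseen_of_sum_variance_eq_one (ξ := fun i ω => b i / √v * ε i ω)
    (h.indep.comp (fun i x => b i / √v * x) fun i => by fun_prop)
    (fun i => (h.memLp_three i).const_mul _)
    (fun i => by rw [integral_const_mul, h.integral_eq_zero, mul_zero]) h_var (x / √v)
  simp only [h_scale, div_le_div_iff_of_pos_right h_sqrt] at h_be
  refine h_be.trans ?_
  rw [mul_assoc, mul_div_assoc]
  exact mul_le_mul_of_nonneg_left (h.sum_integral_abs_pow_three_le hA hs) (by norm_num)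

lemma abs_measureReal_tsum_sub_stdCDF_le_of_sum (h : IsInnovationSequence P ε)
    (hb : Summable fun i => |b i|) (hv : 0 < ∑' i, b i ^ 2) {K : ℝ}
    (hK : ∀ s : Finset ℤ, 0 < ∑ i ∈ s, b i ^ 2 → ∀ y,
      |P.real {ω | ∑ i ∈ s, b i * ε i ω ≤ y} - stdCDF (y / √(∑ i ∈ s, b i ^ 2))|
        ≤ K / √(∑ i ∈ s, b i ^ 2)) (x : ℝ) :
    |P.real {ω | ∑' i, b i * ε i ω ≤ x} - stdCDF (x / √(∑' i, b i ^ 2))|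
      ≤ K / √(∑' i, b i ^ 2) := by
  have := h.indep.isProbabilityMeasure
  set v := ∑' i, b i ^ 2
  obtain ⟨s, hs⟩ := exists_seq_tendsto (atTop : Filter (Finset ℤ))
  have hv_lim : Tendsto (fun J => ∑ i ∈ s J, b i ^ 2) atTop (𝓝 v) :=
    (summable_sq_of_summable hb.of_abs).hasSum.comp hs
  have h_sqrt_lim := hv_lim.sqrt
  have h_sqrt : √v ≠ 0 := (Real.sqrt_pos.2 hv).ne'
  refine abs_measureReal_sub_le_of_tendsto_ae
    (T := fun J ω => ∑ i ∈ s J, b i * ε i ω) (F := fun y => stdCDF (y / √v))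
    (fun J => ?_) ?_ (continuous_stdCDF.comp (by fun_prop)) (fun y δ hδ => ?_) x
  · exact Finset.aestronglyMeasurable_fun_sum _ fun i _ =>
      (h.memLp_three i).aestronglyMeasurable.const_mul _
  · filter_upwards [h.ae_summable_mul hb] with ω hω
    exact hω.of_abs.hasSum.comp hs
  · have h_bound : Tendsto (fun J => K / √(∑ i ∈ s J, b i ^ 2)
        + |stdCDF (y / √(∑ i ∈ s J, b i ^ 2)) - stdCDF (y / √v)|) atTop (𝓝 (K / √v)) := by
      have h_div (c : ℝ) : Tendsto (fun J => c / √(∑ i ∈ s J, b i ^ 2)) atTop (𝓝 (c / √v)) :=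
        tendsto_const_nhds.div h_sqrt_lim h_sqrt
      simpa using (h_div K).add
        (((continuous_stdCDF.tendsto _).comp (h_div y)).sub_const (stdCDF (y / √v))).abs
    filter_upwards [h_bound.eventually_le_const (lt_add_of_pos_right _ hδ),
      hv_lim.eventually_const_lt hv] with J hJ hJv
    exact (abs_sub_le _ _ _).trans ((add_le_add_left (hK (s J) hJv y) _).trans hJ)

theorem abs_measureReal_tsum_sub_stdCDF_le (h : IsInnovationSequence P ε)
    (hb : Summable fun i => |b i|) (hv : 0 < ∑' i, b i ^ 2) {A : ℝ} (hA : ∀ i, |b i| ≤ A)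
    (x : ℝ) :
    |P.real {ω | ∑' i, b i * ε i ω ≤ x} - stdCDF (x / √(∑' i, b i ^ 2))|
      ≤ 110 * (∫ ω, |ε 0 ω| ^ 3 ∂P) * A / √(∑' i, b i ^ 2) :=
  h.abs_measureReal_tsum_sub_stdCDF_le_of_sum hb hv
    (fun _ hs => h.abs_measureReal_sum_sub_stdCDF_le hA hs) x

lemma map_sum_of_gaussian (h : IsInnovationSequence P ε)
    (hg : P.map (ε 0) = gaussianReal 0 1) (s : Finset ℤ) :
    P.map (fun ω => ∑ i ∈ s, b i * ε i ω)
      = gaussianReal 0 (∑ i ∈ s, b i ^ 2).toNNReal := by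
  have h_meas (i : ℤ) : AEMeasurable (ε i) P := (h.memLp_three i).aemeasurable
  have h_indep : iIndepFun (fun i ω => b i * ε i ω) P :=
    h.indep.comp (fun i x => b i * x) fun i => by fun_prop
  have h_law (i : ℤ) : P.map (fun ω => b i * ε i ω) = gaussianReal 0 (b i ^ 2).toNNReal := by
    have h_map := AEMeasurable.map_map_of_aemeasurable (g := fun x => b i * x) (by fun_prop)
      (h_meas i)
    rw [(h.identDistrib i).map_eq, hg, gaussianReal_map_const_mul, mul_zero, mul_one] at h_map
    rw [Real.toNNReal_of_nonneg (sq_nonneg _)]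
    exact h_map.symm
  have := h.indep.isProbabilityMeasure
  induction s using Finset.induction_on with
  | empty => simp
  | insert i s hi ih =>
    have h_sum := gaussianReal_add_gaussianReal_of_indepFun
      (h_indep.indepFun_finsetSum_of_notMem₀ (fun j => (h_meas j).const_mul _) hi).symm
      (h_law i) (by simpa only [Finset.sum_fn] using ih)
    rw [add_zero, ← Real.toNNReal_add (sq_nonneg _) (Finset.sum_nonneg fun j _ => sq_nonneg _)]
      at h_sum
    rw [Finset.sum_insert hi, ← h_sum]
    congr 1
    ext ω
    simp [Finset.sum_insert hi]

theorem measureReal_tsum_le_of_gaussian (h : IsInnovationSequence P ε)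
    (hg : P.map (ε 0) = gaussianReal 0 1) (hb : Summable fun i => |b i|)
    (hv : 0 < ∑' i, b i ^ 2) (x : ℝ) :
    P.real {ω | ∑' i, b i * ε i ω ≤ x} = stdCDF (x / √(∑' i, b i ^ 2)) := by
  refine sub_eq_zero.1 (abs_nonpos_iff.1 ?_)
  refine (h.abs_measureReal_tsum_sub_stdCDF_le_of_sum hb hv (K := 0) (fun s hs y => ?_) x).trans_eq
    (zero_div _)
  have h_meas : AEMeasurable (fun ω => ∑ i ∈ s, b i * ε i ω) P :=
    Finset.aemeasurable_fun_sum _ fun i _ => (h.memLp_three i).aemeasurable.const_mul _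
  have h_law := gaussianReal_real_Iic (Real.toNNReal_pos.2 hs).ne' y
  rw [← h.map_sum_of_gaussian hg, Real.coe_toNNReal _ hs.le,
    map_measureReal_apply_of_aemeasurable h_meas measurableSet_Iic] at h_law
  rw [zero_div, abs_nonpos_iff, sub_eq_zero]
  exact h_law

end IsInnovationSequence

end WeightedSums

/-! ### The variance of the partial sums -/

section WindowSum

/-- The coefficient `a_{1-i} + ⋯ + a_{n-i}` of the `i`-th innovation in the sum over `1 ≤ k ≤ n` of
the moving averages `∑_i a_{k-i} ε_i`. -/
def windowSum (a : ℤ → ℝ) (n : ℕ) (i : ℤ) : ℝ := ∑ k ∈ Finset.Icc (1 : ℤ) n, a (k - i)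

variable {a : ℤ → ℝ}

lemma hasSum_windowSum (ha : Summable a) (n : ℕ) :
    HasSum (windowSum a n) (n * ∑' j, a j) := by
  have h_shift (k : ℤ) : HasSum (fun i => a (k - i)) (∑' j, a j) :=
    (Equiv.subLeft k).hasSum_iff.2 ha.hasSum
  rw [show n * ∑' j, a j = ∑ _k ∈ Finset.Icc (1 : ℤ) n, ∑' j, a j by simp]
  exact hasSum_sum fun k _ => h_shift k

lemma windowSum_nonneg (ha : 0 ≤ a) (n : ℕ) (i : ℤ) : 0 ≤ windowSum a n i :=
  Finset.sum_nonneg fun _ _ => ha _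

lemma windowSum_le_tsum (ha0 : 0 ≤ a) (ha : Summable a) (n : ℕ) (i : ℤ) :
    windowSum a n i ≤ ∑' j, a j := by
  rw [← (Equiv.subRight i).tsum_eq a]
  exact ((Equiv.subRight i).summable_iff.2 ha).sum_le_tsum _ fun k _ => ha0 _

lemma abs_windowSum_le (a : ℤ → ℝ) (n : ℕ) (i : ℤ) : |windowSum a n i| ≤ windowSum |a| n i :=
  Finset.abs_sum_le_sum_abs _ _

lemma abs_tsum_sub_windowSum_le (ha : Summable a) (n : ℕ) (i : ℤ) :
    |∑' j, a j - windowSum a n i| ≤ ∑' j, |a j| - windowSum |a| n i := by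
  have h_add := windowSum_le_tsum (fun j => neg_le_iff_add_nonneg.1 (neg_abs_le (a j)))
    (ha.add ha.abs) n i
  have h_sub := windowSum_le_tsum (fun j => sub_nonneg.2 (le_abs_self (a j)))
    (ha.abs.sub ha) n i
  rw [ha.tsum_add ha.abs] at h_add
  rw [ha.abs.tsum_sub ha] at h_sub
  simp only [windowSum, Finset.sum_add_distrib, Finset.sum_sub_distrib, Pi.abs_apply]
    at h_add h_sub ⊢
  rw [abs_le]
  constructor <;> linarith

lemma hasSum_windowSum_mul_tsum_sub (ha : Summable a) (n : ℕ) :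
    HasSum (fun i => windowSum a n i * (∑' j, a j - windowSum a n i))
      (n * (∑' j, a j) ^ 2 - ∑' i, windowSum a n i ^ 2) := by
  have h_window := hasSum_windowSum ha n
  simpa only [mul_sub, sq, mul_assoc] using (h_window.mul_right (∑' j, a j)).sub
    (summable_sq_of_summable h_window.summable).hasSum

/-- The sum over `1 ≤ i ≤ n` of the part of `∑_j a_j` which the `i`-th window sum misses. For the
coefficients `|α_j|` of a causal process this is `n * biasTerm α n`. -/
def missingMass (a : ℤ → ℝ) (n : ℕ) : ℝ :=
  ∑ i ∈ Finset.Icc (1 : ℤ) n, (∑' j, a j - windowSum a n i)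

-- Innovations inside `[1, n]` have `B_i (A - B_i) ≤ A (A - B_i)`, those outside have
-- `B_i (A - B_i) ≤ A B_i`; as `∑ B_i = n A`, both groups contribute at most `A · missingMass`.
lemma abs_mul_sq_tsum_sub_tsum_sq_le (ha : Summable a) (n : ℕ) :
    |n * (∑' j, a j) ^ 2 - ∑' i, windowSum a n i ^ 2|
      ≤ 2 * (∑' j, |a j|) * missingMass |a| n := by
  set A := ∑' j, |a j|
  set s := Finset.Icc (1 : ℤ) n
  have h_nonneg (i : ℤ) : 0 ≤ windowSum |a| n i := windowSum_nonneg (fun _ => abs_nonneg _) n i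
  have h_le (i : ℤ) : windowSum |a| n i ≤ A := windowSum_le_tsum (fun _ => abs_nonneg _) ha.abs n i
  have h_total : n * A + ∑ i ∈ s, (A - 2 * windowSum |a| n i) = 2 * missingMass |a| n := by
    have h_card : (s.card : ℝ) = n := by simp [s]
    simp only [missingMass, Finset.sum_sub_distrib, ← Finset.mul_sum, Finset.sum_const,
      nsmul_eq_mul, Pi.abs_apply, ← h_card, s, A]
    ring
  have h_majorant : HasSum (fun i => A * (windowSum |a| n i
      + if i ∈ s then A - 2 * windowSum |a| n i else 0)) (A * (2 * missingMass |a| n)) := by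
    rw [← h_total, ← Finset.sum_congr rfl fun i hi => if_pos hi]
    exact ((hasSum_windowSum ha.abs n).add
      (hasSum_sum_of_ne_finset_zero fun i hi => if_neg hi)).mul_left A
  rw [mul_comm 2 A, mul_assoc]
  refine (hasSum_windowSum_mul_tsum_sub ha n).norm_le_of_bounded h_majorant fun i => ?_
  calc ‖windowSum a n i * (∑' j, a j - windowSum a n i)‖
      ≤ windowSum |a| n i * (A - windowSum |a| n i) := by
        rw [norm_mul]
        exact mul_le_mul (abs_windowSum_le a n i) (abs_tsum_sub_windowSum_le ha n i)
          (norm_nonneg _) (h_nonneg i)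
    _ ≤ A * (windowSum |a| n i + if i ∈ s then A - 2 * windowSum |a| n i else 0) := by
        split_ifs
        · nlinarith [h_nonneg i, h_le i]
        · nlinarith [h_nonneg i, h_le i]

lemma mul_missingMass_le (ha0 : 0 ≤ a) (ha : Summable a) {n : ℕ} {c : ℝ}
    (hc : ∀ i ∈ Finset.Icc (1 : ℤ) n, c ≤ windowSum a n i) :
    c * missingMass a n ≤ n * (∑' j, a j) ^ 2 - ∑' i, windowSum a n i ^ 2 := by
  have h_hasSum := hasSum_windowSum_mul_tsum_sub ha n
  have h_missing (i : ℤ) : 0 ≤ ∑' j, a j - windowSum a n i :=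
    sub_nonneg.2 (windowSum_le_tsum ha0 ha n i)
  calc c * missingMass a n
      ≤ ∑ i ∈ Finset.Icc (1 : ℤ) n, windowSum a n i * (∑' j, a j - windowSum a n i) := by
        rw [missingMass, Finset.mul_sum]
        exact Finset.sum_le_sum fun i hi => mul_le_mul_of_nonneg_right (hc i hi) (h_missing i)
    _ ≤ _ := sum_le_hasSum _ (fun i _ => mul_nonneg (windowSum_nonneg ha0 n i) (h_missing i))
        h_hasSum

end WindowSum

section TwoSided

/-- The extension by zero to `ℤ` of the coefficients of a causal linear process, so that
`X_k = ∑_{i ∈ ℤ} α_{k-i} ε_i`. -/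
def twoSided (α : ℕ → ℝ) : ℤ → ℝ := Function.extend Nat.cast α 0

variable {α : ℕ → ℝ}

@[simp]
lemma twoSided_natCast (α : ℕ → ℝ) (j : ℕ) : twoSided α j = α j :=
  Nat.cast_injective.extend_apply α 0 j

lemma twoSided_of_neg (α : ℕ → ℝ) {i : ℤ} (hi : i < 0) : twoSided α i = 0 :=
  Function.extend_apply' α (0 : ℤ → ℝ) i fun ⟨_, _⟩ => by omega

lemma abs_twoSided (α : ℕ → ℝ) : |twoSided α| = twoSided |α| := by
  ext i
  rcases lt_or_ge i 0 with hi | hi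
  · simp [twoSided_of_neg _ hi]
  · lift i to ℕ using hi
    simp

lemma twoSided_nonneg (hα : 0 ≤ α) : 0 ≤ twoSided α := fun i => by
  rcases lt_or_ge i 0 with hi | hi
  · simp [twoSided_of_neg _ hi]
  · lift i to ℕ using hi
    simpa using hα i

lemma hasSum_twoSided (hα : Summable α) : HasSum (twoSided α) (∑' j, α j) :=
  (hasSum_extend_zero Nat.cast_injective).2 hα.hasSum

lemma windowSum_twoSided_sub {n m : ℕ} (hm : m < n) :
    windowSum (twoSided α) n (n - m) = ∑ j ∈ Finset.range (m + 1), α j := by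
  refine (Finset.sum_of_injOn (fun j : ℕ => (n : ℤ) - m + j) (fun j _ k _ h => by simpa using h)
    (fun j hj => ?_) (fun k hk hk' => ?_) (fun j _ => ?_)).symm
  · simp only [Finset.coe_range, mem_Iio, Finset.coe_Icc, mem_Icc] at hj ⊢
    omega
  · refine twoSided_of_neg α (not_le.1 fun h_nonneg => hk' ⟨(k - (n - m)).toNat, ?_⟩)
    simp only [Finset.coe_range, mem_Iio, Finset.mem_Icc] at hk ⊢
    omega
  · rw [add_sub_cancel_left, twoSided_natCast]

lemma sum_windowSum_twoSided (α : ℕ → ℝ) (n : ℕ) (f : ℝ → ℝ) :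
    ∑ i ∈ Finset.Icc (1 : ℤ) n, f (windowSum (twoSided α) n i)
      = ∑ m ∈ Finset.range n, f (∑ j ∈ Finset.range (m + 1), α j) := by
  refine (Finset.sum_of_injOn (fun m : ℕ => (n : ℤ) - m) (fun j _ k _ h => by simpa using h)
    (fun m hm => ?_) (fun i hi hi' => (hi' ⟨(n - i).toNat, ?_⟩).elim) (fun m hm => ?_)).symm
  · simp only [Finset.coe_range, mem_Iio, Finset.coe_Icc, mem_Icc] at hm ⊢
    omega
  · simp only [Finset.coe_range, mem_Iio, Finset.mem_Icc] at hi ⊢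
    omega
  · rw [windowSum_twoSided_sub (Finset.mem_range.1 hm)]

lemma missingMass_twoSided (hα : Summable α) (n : ℕ) :
    missingMass (twoSided α) n = ∑' j : ℕ, min ((j : ℝ) + 1) n * α (j + 1) := by
  have h_tail (m : ℕ) : HasSum (fun j => if m ≤ j then α (j + 1) else 0)
      (∑' j, α j - ∑ j ∈ Finset.range (m + 1), α j) := by
    rw [← (add_left_injective m).hasSum_iff fun j hj => if_neg fun h => hj ⟨j - m, by simp [h]⟩]
    simpa [Function.comp_def, add_assoc] using (hasSum_nat_add_iff' (m + 1)).2 hα.hasSum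
  have h_count (j : ℕ) : ∑ m ∈ Finset.range n, (if m ≤ j then α (j + 1) else 0)
      = min ((j : ℝ) + 1) n * α (j + 1) := by
    have h_filter : (Finset.range n).filter (· ≤ j) = Finset.range (min (j + 1) n) := by
      ext m
      simp only [Finset.mem_filter, Finset.mem_range]
      omega
    rw [← Finset.sum_filter, h_filter, Finset.sum_const, Finset.card_range, nsmul_eq_mul]
    push_cast
    rfl
  rw [missingMass, (hasSum_twoSided hα).tsum_eq,
    sum_windowSum_twoSided α n fun x => ∑' j, α j - x,
    ← (hasSum_sum fun m (_ : m ∈ Finset.range n) => h_tail m).tsum_eq]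
  exact tsum_congr h_count

lemma missingMass_abs_twoSided (hα : Summable fun j => |α j|) {n : ℕ} (hn : n ≠ 0) :
    missingMass |twoSided α| n = n * biasTerm α n := by
  rw [abs_twoSided, biasTerm, mul_inv_cancel_left₀ (by exact_mod_cast hn)]
  exact missingMass_twoSided hα n

lemma windowSum_twoSided_ge (hα : 0 ≤ α) {n : ℕ} {i : ℤ} (hi : i ∈ Finset.Icc (1 : ℤ) n) :
    α 0 ≤ windowSum (twoSided α) n i := by
  calc α 0 = twoSided α (i - i) := by rw [sub_self]; exact (twoSided_natCast α 0).symm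
    _ ≤ windowSum (twoSided α) n i := Finset.single_le_sum (f := fun k => twoSided α (k - i))
        (fun k _ => twoSided_nonneg hα _) hi

end TwoSided

/-! ### The upper bound -/

section UpperBound

variable {Ω : Type*} {α : ℕ → ℝ} {ε : ℤ → Ω → ℝ}

/-- The variance of `partialSum α ε n` when the innovations have variance one. -/
def partialSumVar (α : ℕ → ℝ) (n : ℕ) : ℝ := ∑' i, windowSum (twoSided α) n i ^ 2

lemma support_twoSided_mul_subset (α : ℕ → ℝ) (x : ℤ → ℝ) (k : ℤ) :
    Function.support (fun i => twoSided α (k - i) * x i) ⊆ range fun j : ℕ => k - j := by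
  intro i hi
  have h_nonneg : 0 ≤ k - i := by
    by_contra! h
    exact hi (by simp [twoSided_of_neg α h])
  exact ⟨(k - i).toNat, by simp only; omega⟩

lemma injective_sub_natCast (k : ℤ) : Function.Injective fun j : ℕ => k - j :=
  fun i j h => by simpa using h

lemma linearProcess_eq_tsum (α : ℕ → ℝ) (ε : ℤ → Ω → ℝ) (k : ℤ) (ω : Ω) :
    linearProcess α ε k ω = ∑' i, twoSided α (k - i) * ε i ω := by
  rw [← (injective_sub_natCast k).tsum_eq (support_twoSided_mul_subset α (ε · ω) k)]
  simp [linearProcess]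

lemma summable_abs_twoSided_sub (hα : Summable fun j => |α j|) (k : ℤ) :
    Summable fun i => |twoSided α (k - i)| :=
  ((Equiv.subLeft k).summable_iff.2 (hasSum_twoSided hα.of_abs).summable).abs

lemma sum_natCast_Icc_one (f : ℤ → ℝ) (n : ℕ) :
    ∑ k ∈ Finset.Icc 1 n, f k = ∑ k ∈ Finset.Icc (1 : ℤ) n, f k := by
  refine Finset.sum_nbij' Nat.cast Int.toNat ?_ ?_ ?_ ?_ ?_ <;>
    simp +contextual <;> omega

lemma biasTerm_nonneg (α : ℕ → ℝ) (n : ℕ) : 0 ≤ biasTerm α n :=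
  mul_nonneg (by positivity) (tsum_nonneg fun j => by positivity)

lemma rate_eq (α : ℕ → ℝ) (n : ℕ) : rate α n = 1 / √n + biasTerm α n := by
  rw [rate, Real.rpow_neg (by positivity), ← Real.sqrt_eq_rpow, one_div]

lemma abs_mul_longRunStd_sq_sub_partialSumVar_le (hα : Summable fun j => |α j|) {n : ℕ}
    (hn : n ≠ 0) :
    |n * longRunStd α ^ 2 - partialSumVar α n| ≤ 2 * (∑' j, |α j|) * (n * biasTerm α n) := by
  have h := abs_mul_sq_tsum_sub_tsum_sq_le (hasSum_twoSided hα.of_abs).summable n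
  have h_abs : ∑' i, |twoSided α i| = ∑' j, |α j| := by
    rw [← (hasSum_twoSided hα).tsum_eq]
    exact tsum_congr fun i => congrFun (abs_twoSided α) i
  rwa [missingMass_abs_twoSided hα hn, h_abs, (hasSum_twoSided hα.of_abs).tsum_eq, ← sq_abs] at h

variable [MeasurableSpace Ω] {P : Measure Ω}

namespace IsInnovationSequence

lemma ae_summable (h : IsInnovationSequence P ε) (hα : Summable fun j => |α j|) (k : ℤ) :
    ∀ᵐ ω ∂P, Summable fun j : ℕ => |α j * ε (k - (j : ℤ)) ω| := by
  filter_upwards [h.ae_summable_mul (summable_abs_twoSided_sub hα k)] with ω hω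
  simpa [Function.comp_def] using hω.comp_injective (injective_sub_natCast k)

lemma partialSum_ae_eq (h : IsInnovationSequence P ε) (hα : Summable fun j => |α j|) (n : ℕ) :
    ∀ᵐ ω ∂P, partialSum α ε n ω = ∑' i, windowSum (twoSided α) n i * ε i ω := by
  filter_upwards [ae_all_iff.2 fun k => h.ae_summable_mul (summable_abs_twoSided_sub hα k)]
    with ω hω
  simp only [partialSum, linearProcess_eq_tsum, windowSum, Finset.sum_mul]
  rw [sum_natCast_Icc_one fun k => ∑' i, twoSided α (k - i) * ε i ω,
    Summable.tsum_finsetSum fun k _ => (hω k).of_abs]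

lemma measureReal_partialSum_le (h : IsInnovationSequence P ε) (hα : Summable fun j => |α j|)
    (n : ℕ) (y : ℝ) :
    P.real {ω | partialSum α ε n ω ≤ y}
      = P.real {ω | ∑' i, windowSum (twoSided α) n i * ε i ω ≤ y} := by
  refine measureReal_congr (eventuallyEq_set.2 ?_)
  filter_upwards [h.partialSum_ae_eq hα n] with ω hω
  simp only [hω]

lemma abs_measureReal_partialSum_sub_stdCDF_le (h : IsInnovationSequence P ε)
    (hα : Summable fun j => |α j|) {n : ℕ} (hv : 0 < partialSumVar α n) (y : ℝ) :
    |P.real {ω | partialSum α ε n ω ≤ y} - stdCDF (y / √(partialSumVar α n))|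
      ≤ 110 * (∫ ω, |ε 0 ω| ^ 3 ∂P) * (∑' j, |α j|) / √(partialSumVar α n) := by
  rw [h.measureReal_partialSum_le hα]
  refine h.abs_measureReal_tsum_sub_stdCDF_le
    (hasSum_windowSum (hasSum_twoSided hα.of_abs).summable n).summable.abs hv (fun i => ?_) y
  rw [← (hasSum_twoSided hα).tsum_eq]
  refine (abs_windowSum_le _ n i).trans ?_
  rw [abs_twoSided]
  exact windowSum_le_tsum (twoSided_nonneg fun j => abs_nonneg _) (hasSum_twoSided hα).summable n i

lemma abs_measureReal_partialSum_sub_le_of_biasTerm_le (h : IsInnovationSequence P ε)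
    (hα : IsAdmissibleCoeff α) {n : ℕ} (hn : n ≠ 0)
    (h_bias : 8 * (∑' j, |α j|) * biasTerm α n ≤ longRunStd α ^ 2) (y : ℝ) :
    |P.real {ω | partialSum α ε n ω ≤ y} - stdCDF (y / √(n * longRunStd α ^ 2))|
      ≤ 220 * (∫ ω, |ε 0 ω| ^ 3 ∂P) * (∑' j, |α j|) / longRunStd α * (1 / √n)
        + 4 * (∑' j, |α j|) / longRunStd α ^ 2 * biasTerm α n := by
  set A := ∑' j, |α j|
  set R := biasTerm α n
  set v := partialSumVar α n
  set w := n * longRunStd α ^ 2 with hw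
  have hs : 0 < longRunStd α := abs_pos.2 hα.tsum_ne_zero
  have : 0 ≤ ∫ ω, |ε 0 ω| ^ 3 ∂P := integral_nonneg fun ω => by positivity
  have : 0 ≤ A := tsum_nonneg fun j => abs_nonneg _
  have hn0 : (0 : ℝ) < n := by positivity
  have hw0 : 0 < w := by positivity
  have h_var : |w - v| ≤ 2 * A * (n * R) :=
    abs_mul_longRunStd_sq_sub_partialSumVar_le hα.summable_abs hn
  have h_var' : 2 * A * (n * R) ≤ w / 4 := by nlinarith
  have h_close := abs_le.1 (h_var.trans h_var')
  have h_sqrt : √n * longRunStd α / 2 ≤ √v := by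
    refine Real.le_sqrt_of_sq_le ?_
    rw [div_pow, mul_pow, Real.sq_sqrt hn0.le]
    linarith
  have h_be := h.abs_measureReal_partialSum_sub_stdCDF_le hα.summable_abs
    (show 0 < v by linarith) y
  have h_change := abs_stdCDF_div_sqrt_sub_le hw0 (v := v) (by linarith) (by linarith) y
  have h_ratio : |v / w - 1| ≤ 2 * A * (n * R) / w := by
    rw [div_sub_one hw0.ne', abs_div, abs_of_pos hw0, abs_sub_comm]
    gcongr
  calc _ ≤ 110 * (∫ ω, |ε 0 ω| ^ 3 ∂P) * A / √v + 2 * |v / w - 1| :=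
        (abs_sub_le _ _ _).trans (add_le_add h_be h_change)
    _ ≤ 110 * (∫ ω, |ε 0 ω| ^ 3 ∂P) * A / (√n * longRunStd α / 2)
        + 2 * (2 * A * (n * R) / w) := by gcongr
    _ = _ := by rw [hw]; field_simp; ring

end IsInnovationSequence

lemma abs_measureReal_sub_le_normalDistance (P : Measure Ω) [IsProbabilityMeasure P]
    (α : ℕ → ℝ) (ε : ℤ → Ω → ℝ) (n : ℕ) (x : ℝ) :
    |P.real {ω | partialSum α ε n ω ≤ x * √(n * longRunStd α ^ 2)} - stdCDF x|
      ≤ normalDistance P α ε n := by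
  refine le_ciSup (f := fun x => |P.real {ω | partialSum α ε n ω ≤
    x * √(n * longRunStd α ^ 2)} - stdCDF x|) ⟨1, ?_⟩ x
  rintro _ ⟨x, rfl⟩
  exact abs_measureReal_sub_stdCDF_le_one _ x

lemma normalDistance_le_one (P : Measure Ω) [IsProbabilityMeasure P] (α : ℕ → ℝ)
    (ε : ℤ → Ω → ℝ) (n : ℕ) : normalDistance P α ε n ≤ 1 :=
  ciSup_le fun x => abs_measureReal_sub_stdCDF_le_one _ x

theorem IsInnovationSequence.normalDistance_le (h : IsInnovationSequence P ε)
    (hα : IsAdmissibleCoeff α) {n : ℕ} (hn : n ≠ 0) :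
    normalDistance P α ε n
      ≤ (220 * (∫ ω, |ε 0 ω| ^ 3 ∂P) * (∑' j, |α j|) / longRunStd α
        + 8 * (∑' j, |α j|) / longRunStd α ^ 2) * rate α n := by
  have := h.indep.isProbabilityMeasure
  set A := ∑' j, |α j|
  set R := biasTerm α n
  have hs : 0 < longRunStd α := abs_pos.2 hα.tsum_ne_zero
  have : 0 ≤ ∫ ω, |ε 0 ω| ^ 3 ∂P := integral_nonneg fun ω => by positivity
  have : 0 ≤ A := tsum_nonneg fun j => abs_nonneg _
  have hR : 0 ≤ R := biasTerm_nonneg α n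
  set c := 220 * (∫ ω, |ε 0 ω| ^ 3 ∂P) * A / longRunStd α
  have h_split : c * (1 / √n) + 8 * A / longRunStd α ^ 2 * R
      ≤ (c + 8 * A / longRunStd α ^ 2) * rate α n := by
    rw [rate_eq, add_mul]
    gcongr
    · exact le_add_of_nonneg_right hR
    · exact le_add_of_nonneg_left (by positivity)
  refine le_trans ?_ h_split
  rcases le_total (8 * A * R) (longRunStd α ^ 2) with h_bias | h_bias
  · refine ciSup_le fun x => ?_
    have h_le := h.abs_measureReal_partialSum_sub_le_of_biasTerm_le hα hn h_bias
      (x * √(n * longRunStd α ^ 2))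
    rw [mul_div_cancel_right₀ _ (by positivity)] at h_le
    refine h_le.trans (add_le_add_right ?_ _)
    gcongr
    norm_num
  · refine (normalDistance_le_one P α ε n).trans ?_
    have : 1 ≤ 8 * A / longRunStd α ^ 2 * R := by
      rwa [div_mul_eq_mul_div, one_le_div (by positivity)]
    linarith [show 0 ≤ c * (1 / √n) by positivity]

end UpperBound

/-! ### Sharpness -/

lemma isInnovationSequence_infinitePi (μ : Measure ℝ) [IsProbabilityMeasure μ]
    (h1 : ∫ x, x ∂μ = 0) (h2 : ∫ x, x ^ 2 ∂μ = 1) (h3 : Integrable (fun x => |x| ^ 3) μ) :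
    IsInnovationSequence (Measure.infinitePi fun _ : ℤ => μ) fun i ω => ω i := by
  have h_eval (i : ℤ) : MeasurePreserving (fun ω : ℤ → ℝ => ω i)
      (Measure.infinitePi fun _ : ℤ => μ) μ :=
    measurePreserving_eval_infinitePi (fun _ : ℤ => μ) i
  have h_integral {f : ℝ → ℝ} (hf : Measurable f) :
      ∫ ω : ℤ → ℝ, f (ω 0) ∂Measure.infinitePi (fun _ : ℤ => μ) = ∫ x, f x ∂μ :=
    (integral_map (h_eval 0).aemeasurable hf.aestronglyMeasurable).symm.trans
      (by rw [(h_eval 0).map_eq])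
  exact {
    indep := iIndepFun_infinitePi (P := fun _ : ℤ => μ) (X := fun _ x => x) fun _ => measurable_id
    identDistrib := fun i => ⟨(h_eval i).aemeasurable, (h_eval 0).aemeasurable, by
      rw [(h_eval i).map_eq, (h_eval 0).map_eq]⟩
    mean_eq_zero := (h_integral measurable_id).trans h1
    second_moment := (h_integral (measurable_id.pow_const 2)).trans h2
    third_moment := (h_eval 0).integrable_comp_of_integrable h3 }

section Lattice

/-- The law of a fair random sign. -/
def rademacher : Measure ℝ :=
  (1 / 2 : ENNReal) • Measure.dirac 1 + (1 / 2 : ENNReal) • Measure.dirac (-1)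

instance : IsProbabilityMeasure rademacher := ⟨by
  simp [rademacher, ENNReal.inv_two_add_inv_two]⟩

lemma integrable_rademacher (f : ℝ → ℝ) : Integrable f rademacher := by
  have h_dirac (a : ℝ) : Integrable f (Measure.dirac a) := integrable_dirac (by simp)
  exact ((h_dirac 1).smul_measure (by simp)).add_measure ((h_dirac (-1)).smul_measure (by simp))

lemma integral_rademacher (f : ℝ → ℝ) : ∫ x, f x ∂rademacher = (f 1 + f (-1)) / 2 := by
  have h_dirac (a : ℝ) : Integrable f (Measure.dirac a) := integrable_dirac (by simp)
  rw [rademacher, integral_add_measure ((h_dirac 1).smul_measure (by simp))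
    ((h_dirac (-1)).smul_measure (by simp)), integral_smul_measure, integral_smul_measure,
    integral_dirac, integral_dirac]
  simp only [one_div, ENNReal.toReal_inv, ENNReal.toReal_ofNat, smul_eq_mul]
  ring

lemma ae_rademacher : ∀ᵐ x ∂rademacher, x = 1 ∨ x = -1 := by
  rw [rademacher, ae_add_measure_iff]
  constructor <;> exact Measure.ae_smul_measure (by simp [ae_dirac_eq]) _

lemma isInnovationSequence_rademacher :
    IsInnovationSequence (Measure.infinitePi fun _ : ℤ => rademacher) fun i ω => ω i := by
  refine isInnovationSequence_infinitePi _ ?_ ?_ (integrable_rademacher _)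
  · rw [integral_rademacher fun x => x]; norm_num
  · rw [integral_rademacher fun x => x ^ 2]; norm_num

/-- The coefficients of the linear process `X_k = ε_k`. -/
def unitCoeff : ℕ → ℝ := Pi.single 0 1

lemma tsum_unitCoeff : ∑' j, unitCoeff j = 1 := tsum_pi_single 0 1

lemma isAdmissibleCoeff_unitCoeff : IsAdmissibleCoeff unitCoeff where
  summable_abs := (hasSum_pi_single 0 (1 : ℝ)).summable.abs
  tsum_ne_zero := tsum_unitCoeff ▸ one_ne_zero

lemma biasTerm_unitCoeff (n : ℕ) : biasTerm unitCoeff n = 0 := by simp [biasTerm, unitCoeff]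

lemma linearProcess_unitCoeff {Ω : Type*} (ε : ℤ → Ω → ℝ) (k : ℤ) (ω : Ω) :
    linearProcess unitCoeff ε k ω = ε k ω := by
  rw [linearProcess, tsum_eq_single 0 fun j hj => by simp [unitCoeff, hj]]
  simp [unitCoeff]

variable {Ω : Type*} [MeasurableSpace Ω] {P : Measure Ω}

lemma measureReal_le_half_eq_of_ae_int {X : Ω → ℝ} (hX : ∀ᵐ ω ∂P, ∃ m : ℤ, X ω = m) :
    P.real {ω | X ω ≤ 1 / 2} = P.real {ω | X ω ≤ 0} := by
  refine measureReal_congr (eventuallyEq_set.2 ?_)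
  filter_upwards [hX] with ω ⟨m, hm⟩
  rw [hm]
  refine ⟨fun h_half => ?_, fun h_zero => h_zero.trans (by norm_num)⟩
  have h_lt : (m : ℝ) < 1 := h_half.trans_lt (by norm_num)
  exact_mod_cast Int.lt_add_one_iff.1 (by exact_mod_cast h_lt : m < 0 + 1)

/-- The law of `partialSum α ε n` does not charge `(0, 1 / 2]`, whereas the normal law with standard
deviation `√n` gives this interval a mass of order `1 / √n`. -/
lemma inv_sqrt_le_normalDistance_of_ae_int [IsProbabilityMeasure P] {α : ℕ → ℝ} {ε : ℤ → Ω → ℝ}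
    {n : ℕ} (hn : n ≠ 0) (hs : longRunStd α = 1)
    (h_int : ∀ᵐ ω ∂P, ∃ m : ℤ, partialSum α ε n ω = m) :
    1 / 20 * (1 / √n) ≤ normalDistance P α ε n := by
  have hn1 : 1 ≤ √(n : ℝ) := Real.one_le_sqrt.2 (by exact_mod_cast Nat.one_le_iff_ne_zero.2 hn)
  set x := 1 / (2 * √(n : ℝ)) with hx
  have hx0 : 0 ≤ x := by positivity
  have hx1 : x ≤ 1 := by rw [hx, div_le_one (by positivity)]; linarith
  have hx_mul : x * √(n * longRunStd α ^ 2) = 1 / 2 := by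
    rw [hs, one_pow, mul_one, hx]; field_simp
  have h_gap : 1 / 5 * (x - 0) ≤ stdCDF x - stdCDF 0 :=
    mul_sub_le_stdCDF_sub hx0 fun t ht =>
      one_fifth_le_stdPDF (abs_le.2 ⟨by linarith [ht.1], ht.2.trans hx1⟩)
  have h_zero := abs_measureReal_sub_le_normalDistance P α ε n 0
  have h_half := abs_measureReal_sub_le_normalDistance P α ε n x
  rw [zero_mul] at h_zero
  rw [hx_mul, measureReal_le_half_eq_of_ae_int h_int] at h_half
  have h_eq : 1 / 20 * (1 / √(n : ℝ)) = 1 / 5 * (x - 0) / 2 := by rw [hx]; ring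
  linarith [(abs_le.1 h_zero).2, (abs_le.1 h_half).1]

lemma attainsRate_rademacher :
    AttainsRate (Measure.infinitePi fun _ : ℤ => rademacher) unitCoeff fun i ω => ω i := by
  refine ⟨1 / 20, by norm_num, fun n hn => ?_⟩
  rw [rate_eq, biasTerm_unitCoeff, add_zero]
  refine inv_sqrt_le_normalDistance_of_ae_int (by omega)
    (by rw [longRunStd, tsum_unitCoeff, abs_one]) ?_
  have h_sign : ∀ᵐ ω ∂(Measure.infinitePi fun _ : ℤ => rademacher), ∀ i : ℤ, ω i = 1 ∨ ω i = -1 :=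
    ae_all_iff.2 fun i => (measurePreserving_eval_infinitePi
      (fun _ : ℤ => rademacher) i).quasiMeasurePreserving.ae ae_rademacher
  filter_upwards [h_sign] with ω hω
  refine ⟨∑ k ∈ Finset.Icc 1 n, if ω (k : ℤ) = 1 then 1 else -1, ?_⟩
  rw [partialSum, Int.cast_sum]
  refine Finset.sum_congr rfl fun k _ => ?_
  rw [linearProcess_unitCoeff]
  rcases hω k with h | h <;> rw [h] <;> norm_num

end Lattice

section Gaussian

variable {α : ℕ → ℝ}

lemma mul_biasTerm_le_sub_partialSumVar (hα : 0 ≤ α) (hsum : Summable α) {n : ℕ} (hn : n ≠ 0) :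
    α 0 * (n * biasTerm α n) ≤ n * longRunStd α ^ 2 - partialSumVar α n := by
  rw [← missingMass_abs_twoSided hsum.abs hn, abs_of_nonneg (twoSided_nonneg hα), longRunStd,
    sq_abs, ← (hasSum_twoSided hsum).tsum_eq]
  exact mul_missingMass_le (twoSided_nonneg hα) (hasSum_twoSided hsum).summable
    fun i hi => windowSum_twoSided_ge hα hi

lemma partialSumVar_pos (hα : 0 ≤ α) (h0 : 0 < α 0) (hsum : Summable α) {n : ℕ} (hn : n ≠ 0) :
    0 < partialSumVar α n := by
  have h_summable : Summable fun i => windowSum (twoSided α) n i ^ 2 :=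
    summable_sq_of_summable (hasSum_windowSum (hasSum_twoSided hsum).summable n).summable
  refine h_summable.tsum_pos (fun i => sq_nonneg _) 1 (pow_pos ?_ 2)
  exact h0.trans_le (windowSum_twoSided_ge hα (Finset.mem_Icc.2 ⟨le_rfl, by omega⟩))

lemma one_add_half_le_sqrt_div_sqrt {v w ρ : ℝ} (hv : 0 < v) (hw : 0 ≤ w) (hρ : 0 ≤ ρ)
    (h_le : v ≤ w * (1 - ρ)) : 1 + ρ / 2 ≤ √w / √v := by
  rw [le_div_iff₀ (Real.sqrt_pos.2 hv)]
  apply Real.le_sqrt_of_sq_le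
  rw [mul_pow, Real.sq_sqrt hv.le]
  calc (1 + ρ / 2) ^ 2 * v ≤ (1 + ρ / 2) ^ 2 * (w * (1 - ρ)) := by gcongr
    _ = w - w * (3 / 4 * ρ ^ 2 + ρ ^ 3 / 4) := by ring
    _ ≤ w := sub_le_self _ (by positivity)

lemma stdPDF_two_mul_le_stdCDF_sub {δ : ℝ} (hδ0 : 0 ≤ δ) (hδ1 : δ ≤ 1) :
    stdPDF 2 * δ ≤ stdCDF (1 + δ) - stdCDF 1 := by
  have h_gap := mul_sub_le_stdCDF_sub (x := 1) (y := 1 + δ) (m := stdPDF 2) (by linarith)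
    fun t ht => stdPDF_le_of_abs_le (by
      rw [abs_of_nonneg (by linarith [ht.1]), abs_of_nonneg zero_le_two]; linarith [ht.2])
  rwa [add_sub_cancel_left] at h_gap

lemma IsInnovationSequence.biasTerm_le_normalDistance_of_gaussian {Ω : Type*} [MeasurableSpace Ω]
    {P : Measure Ω} {ε : ℤ → Ω → ℝ} (h : IsInnovationSequence P ε)
    (hg : P.map (ε 0) = gaussianReal 0 1) (hα : 0 ≤ α) (h0 : 0 < α 0) (hsum : Summable α)
    {n : ℕ} (hn : n ≠ 0) :
    α 0 * stdPDF 2 / (2 * longRunStd α ^ 2) * biasTerm α n ≤ normalDistance P α ε n := by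
  have := h.indep.isProbabilityMeasure
  set s := longRunStd α with hs_def
  set v := partialSumVar α n
  set ρ := α 0 * biasTerm α n / s ^ 2 with hρ_def
  have hs : 0 < s := abs_pos.2 (hsum.tsum_pos hα 0 h0).ne'
  have hv : 0 < v := partialSumVar_pos hα h0 hsum hn
  have hρ : 0 ≤ ρ := div_nonneg (mul_nonneg h0.le (biasTerm_nonneg α n)) (sq_nonneg s)
  have hw : 0 < n * s ^ 2 := by positivity
  have h_var : v ≤ n * s ^ 2 * (1 - ρ) := by
    have h_mul : n * s ^ 2 * ρ = α 0 * (n * biasTerm α n) := by rw [hρ_def]; field_simp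
    linarith [mul_biasTerm_le_sub_partialSumVar hα hsum hn]
  have hρ1 : ρ ≤ 1 := by
    linarith [pos_of_mul_pos_right (hv.trans_le h_var) hw.le]
  have h_law : P.real {ω | partialSum α ε n ω ≤ √(n * s ^ 2)} = stdCDF (√(n * s ^ 2) / √v) := by
    rw [h.measureReal_partialSum_le hsum.abs]
    exact h.measureReal_tsum_le_of_gaussian hg
      (hasSum_windowSum (hasSum_twoSided hsum).summable n).summable.abs hv _
  have h_dist := (le_abs_self _).trans (abs_measureReal_sub_le_normalDistance P α ε n 1)
  rw [one_mul, ← hs_def, h_law] at h_dist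
  calc α 0 * stdPDF 2 / (2 * s ^ 2) * biasTerm α n = stdPDF 2 * (ρ / 2) := by rw [hρ_def]; ring
    _ ≤ stdCDF (1 + ρ / 2) - stdCDF 1 :=
        stdPDF_two_mul_le_stdCDF_sub (by linarith) (by linarith)
    _ ≤ stdCDF (√(n * s ^ 2) / √v) - stdCDF 1 :=
        sub_le_sub_right (monotone_stdCDF (one_add_half_le_sqrt_div_sqrt hv hw.le hρ h_var)) _
    _ ≤ normalDistance P α ε n := h_dist

/-- Coefficients `(j + 1) ^ (-5/4)`, which decay so slowly that the bias term, of order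
`n ^ (-1/4)`, dominates the rate. -/
def slowCoeff (j : ℕ) : ℝ := ((j : ℝ) + 1) ^ (-(5 / 4) : ℝ)

lemma slowCoeff_nonneg : 0 ≤ slowCoeff := fun j => by
  rw [Pi.zero_apply, slowCoeff]; positivity

lemma slowCoeff_zero : slowCoeff 0 = 1 := by simp [slowCoeff]

lemma summable_slowCoeff : Summable slowCoeff := by
  have h_pow : Summable fun j : ℕ => (j : ℝ) ^ (-(5 / 4) : ℝ) :=
    Real.summable_nat_rpow.2 (by norm_num)
  exact ((summable_nat_add_iff 1).2 h_pow).congr fun j => by simp [slowCoeff]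

lemma isAdmissibleCoeff_slowCoeff : IsAdmissibleCoeff slowCoeff where
  summable_abs := summable_slowCoeff.abs
  tsum_ne_zero := (summable_slowCoeff.tsum_pos slowCoeff_nonneg 0 (by simp [slowCoeff_zero])).ne'

lemma rpow_div_four_le_min_mul_slowCoeff {i n : ℕ} (hi : i < n) :
    (n : ℝ) ^ (-(1 / 4) : ℝ) / 4 ≤ min ((i : ℝ) + 1) n * |slowCoeff (i + 1)| := by
  set t : ℝ := i + 1 + 1
  have hin : (i : ℝ) + 1 ≤ n := by exact_mod_cast hi
  have ht : 0 < t := by positivity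
  have h_pow : t * t ^ (-(5 / 4) : ℝ) = t ^ (-(1 / 4) : ℝ) := by
    rw [← Real.rpow_one_add' ht.le (by norm_num)]; norm_num
  have h_sixteen : (16 : ℝ) ^ (-(1 / 4) : ℝ) = 1 / 2 := by
    rw [show (16 : ℝ) = 2 ^ (4 : ℝ) by norm_num, ← Real.rpow_mul zero_le_two]; norm_num
  calc (n : ℝ) ^ (-(1 / 4) : ℝ) / 4 = (16 * n : ℝ) ^ (-(1 / 4) : ℝ) / 2 := by
        rw [Real.mul_rpow (by norm_num) n.cast_nonneg, h_sixteen]; ring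
    _ ≤ t ^ (-(1 / 4) : ℝ) / 2 := by
        gcongr ?_ / 2
        exact Real.rpow_le_rpow_of_nonpos ht (by linarith) (by norm_num)
    _ = t / 2 * t ^ (-(5 / 4) : ℝ) := by rw [← h_pow]; ring
    _ ≤ (i + 1) * t ^ (-(5 / 4) : ℝ) := by gcongr; linarith
    _ = min ((i : ℝ) + 1) n * |slowCoeff (i + 1)| := by
        rw [min_eq_left hin, abs_of_nonneg (slowCoeff_nonneg _), slowCoeff, Nat.cast_succ]

lemma le_biasTerm_slowCoeff {n : ℕ} (hn : n ≠ 0) :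
    (n : ℝ) ^ (-(1 / 4) : ℝ) / 4 ≤ biasTerm slowCoeff n := by
  have h_summable : Summable fun j : ℕ => min ((j : ℝ) + 1) n * |slowCoeff (j + 1)| :=
    (((summable_nat_add_iff 1).2 summable_slowCoeff.abs).mul_left (n : ℝ)).of_nonneg_of_le
      (fun j => by positivity) fun j => by gcongr; exact min_le_right _ _
  rw [biasTerm, le_inv_mul_iff₀ (by positivity)]
  calc (n : ℝ) * ((n : ℝ) ^ (-(1 / 4) : ℝ) / 4)
      = ∑ _j ∈ Finset.range n, (n : ℝ) ^ (-(1 / 4) : ℝ) / 4 := by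
        rw [Finset.sum_const, Finset.card_range, nsmul_eq_mul]
    _ ≤ ∑ j ∈ Finset.range n, min ((j : ℝ) + 1) n * |slowCoeff (j + 1)| :=
        Finset.sum_le_sum fun j hj => rpow_div_four_le_min_mul_slowCoeff (Finset.mem_range.1 hj)
    _ ≤ ∑' j : ℕ, min ((j : ℝ) + 1) n * |slowCoeff (j + 1)| :=
        h_summable.sum_le_tsum _ fun j _ => by positivity

lemma tendsto_sqrt_mul_biasTerm_slowCoeff :
    Tendsto (fun n : ℕ => √(n : ℝ) * biasTerm slowCoeff n) atTop atTop := by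
  have h_pow : Tendsto (fun n : ℕ => (n : ℝ) ^ (1 / 4 : ℝ) / 4) atTop atTop :=
    ((tendsto_rpow_atTop (by norm_num)).comp tendsto_natCast_atTop_atTop).atTop_div_const
      (by norm_num)
  refine tendsto_atTop_mono' _ ?_ h_pow
  filter_upwards [eventually_ne_atTop 0] with n hn
  calc (n : ℝ) ^ (1 / 4 : ℝ) / 4 = √(n : ℝ) * ((n : ℝ) ^ (-(1 / 4) : ℝ) / 4) := by
        rw [Real.sqrt_eq_rpow, ← mul_div_assoc, ← Real.rpow_add (by positivity)]; norm_num
    _ ≤ √(n : ℝ) * biasTerm slowCoeff n := by gcongr; exact le_biasTerm_slowCoeff hn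

lemma rate_slowCoeff_le {n : ℕ} (hn : n ≠ 0) : rate slowCoeff n ≤ 5 * biasTerm slowCoeff n := by
  have h_pow : (n : ℝ) ^ (-(1 / 2) : ℝ) ≤ (n : ℝ) ^ (-(1 / 4) : ℝ) :=
    Real.rpow_le_rpow_of_exponent_le (by exact_mod_cast Nat.one_le_iff_ne_zero.2 hn) (by norm_num)
  rw [rate]
  linarith [le_biasTerm_slowCoeff hn]

lemma isInnovationSequence_gaussian :
    IsInnovationSequence (Measure.infinitePi fun _ : ℤ => gaussianReal 0 1) fun i ω => ω i := by
  refine isInnovationSequence_infinitePi _ integral_id_gaussianReal ?_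
    (integrable_abs_pow_three (memLp_id_gaussianReal 3))
  rw [← variance_of_integral_eq_zero (by fun_prop) integral_id_gaussianReal,
    variance_fun_id_gaussianReal, NNReal.coe_one]

lemma attainsRate_gaussian :
    AttainsRate (Measure.infinitePi fun _ : ℤ => gaussianReal 0 1) slowCoeff fun i ω => ω i := by
  have hs : 0 < longRunStd slowCoeff := abs_pos.2 isAdmissibleCoeff_slowCoeff.tsum_ne_zero
  have h0 : 0 < slowCoeff 0 := by simp [slowCoeff_zero]
  set c := slowCoeff 0 * stdPDF 2 / (2 * longRunStd slowCoeff ^ 2)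
  have hc : 0 < c := div_pos (mul_pos h0 (stdPDF_pos 2)) (by positivity)
  refine ⟨c / 5, by positivity, fun n hn => ?_⟩
  have hn' : n ≠ 0 := Nat.one_le_iff_ne_zero.1 hn
  calc c / 5 * rate slowCoeff n ≤ c / 5 * (5 * biasTerm slowCoeff n) := by
        gcongr; exact rate_slowCoeff_le hn'
    _ = c * biasTerm slowCoeff n := by ring
    _ ≤ _ := isInnovationSequence_gaussian.biasTerm_le_normalDistance_of_gaussian
        (measurePreserving_eval_infinitePi (fun _ : ℤ => gaussianReal 0 1) 0).map_eq
        slowCoeff_nonneg h0 summable_slowCoeff hn'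

end Gaussian

end

theorem proposition5p1 :
    -- Upper bound; the constant depends only on `∑ |α_j|`, `|∑ α_j|` and `E|ε_0|³`.
    (∃ C : ℝ → ℝ → ℝ → ℝ,
      ∀ (Ω : Type*) [MeasurableSpace Ω] (P : Measure Ω) [IsProbabilityMeasure P]
        (α : ℕ → ℝ) (ε : ℤ → Ω → ℝ),
        IsAdmissibleCoeff α → IsInnovationSequence P ε →
          -- the series defining `X_k` converges absolutely almost surely
          (∀ k : ℤ, ∀ᵐ ω ∂P, Summable fun j : ℕ => |α j * ε (k - (j : ℤ)) ω|) ∧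
          ∀ n : ℕ, 1 ≤ n →
            normalDistance P α ε n
              ≤ C (∑' j, |α j|) (longRunStd α) (∫ ω, |ε 0 ω| ^ 3 ∂P) * rate α n) ∧
    -- Sharpness when the second term of the rate dominates.
    (∃ (Ω : Type) (_ : MeasurableSpace Ω) (P : Measure Ω) (_ : IsProbabilityMeasure P)
        (α : ℕ → ℝ) (ε : ℤ → Ω → ℝ),
        IsAdmissibleCoeff α ∧ IsInnovationSequence P ε ∧
          Tendsto (fun n : ℕ => √(n : ℝ) * biasTerm α n) atTop atTop ∧ AttainsRate P α ε) ∧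
    -- Sharpness when the first term of the rate dominates.
    (∃ (Ω : Type) (_ : MeasurableSpace Ω) (P : Measure Ω) (_ : IsProbabilityMeasure P)
        (α : ℕ → ℝ) (ε : ℤ → Ω → ℝ),
        IsAdmissibleCoeff α ∧ IsInnovationSequence P ε ∧
          (∃ K : ℝ, ∀ n : ℕ, √(n : ℝ) * biasTerm α n ≤ K) ∧ AttainsRate P α ε) := by
  refine ⟨⟨fun A s β => 220 * β * A / s + 8 * A / s ^ 2, ?_⟩, ?_, ?_⟩
  · intro Ω _ P _ α ε hα hε
    exact ⟨fun k => hε.ae_summable hα.summable_abs k,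
      fun n hn => hε.normalDistance_le hα (Nat.one_le_iff_ne_zero.1 hn)⟩
  · exact ⟨ℤ → ℝ, inferInstance, Measure.infinitePi fun _ : ℤ => gaussianReal 0 1, inferInstance,
      slowCoeff, fun i ω => ω i, isAdmissibleCoeff_slowCoeff, isInnovationSequence_gaussian,
      tendsto_sqrt_mul_biasTerm_slowCoeff, attainsRate_gaussian⟩
  · exact ⟨ℤ → ℝ, inferInstance, Measure.infinitePi fun _ : ℤ => rademacher, inferInstance,
      unitCoeff, fun i ω => ω i, isAdmissibleCoeff_unitCoeff, isInnovationSequence_rademacher,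
      ⟨0, fun n => by rw [biasTerm_unitCoeff, mul_zero]⟩, attainsRate_rademacher⟩
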